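/- Let $W_2=\mathrm{Tot}(\mathcal O_{\mathbb P^1}(-2)\oplus\mathcal O_{\mathbb P^1})$, that is, the complex threefold obtained from two charts $U=\mathbb C^3=\{(z,u_1,u_2)\}$ and $V=\mathbb C^3=\{(\xi,v_1,v_2)\}$ glued over $U\cap V=(\mathbb C\setminus\{0\})\times\mathbb C^2$ by $(\xi,v_1,v_2)=(z^{-1},z^2u_1,u_2)$. Let $H^1(W_2,\mathrm{End}(TW_2))$ be the first cohomology of the sheaf of holomorphic endomorphisms of the tangent bundle, computed by the Čech complex of the covering $\{U,V\}$: it is $\Gamma(U\cap V,\mathrm{End}(TW_2))$ modulo $\{\,b|_{U\cap V}-a|_{U\cap V} : a\in\Gamma(U,\mathrm{End}(TW_2)),\ b\in\Gamma(V,\mathrm{End}(TW_2))\,\}$. Then $W_2$ has infinite-dimensional moduli of holomorphic bundles, in the following sense. 1. The Zariski tangent space at $TW_2$ of the moduli of holomorphic bundles on $W_2$, i.e. the set of isomorphism classes of first-order deformations of $TW_2$ (obtained by gluing $TW_2[\varepsilon]|_U$ and $TW_2[\varepsilon]|_V$, $\varepsilon^2=0$, by an automorphism $1+\varepsilon\sigma$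 over $U\cap V$; isomorphisms are the identity modulo $\varepsilon$), is in bijection with $H^1(W_2,\mathrm{End}(TW_2))$ by sending the deformation glued by $1+\varepsilon\sigma$ to the class of $\sigma$. 2. The complex vector space $H^1(W_2,\mathrm{End}(TW_2))$ is infinite-dimensional. 3. For every $n\ge 0$ there is a holomorphic family $(E_t)_{t\in\mathbb C^n}$ of vector bundles on $W_2$ with $E_0=TW_2$ (where $E_t$ is glued from $TW_2|_U$ and $TW_2|_V$ by an automorphism $\theta_t$ of $TW_2|_{U\cap V}$ that is jointly holomorphic in $t$ and the point, with $\theta_0=1$) whose Kodaira–Spencer map $\mathbb C^n\to H^1(W_2,\mathrm{End}(TW_2))$, $v\mapsto[\partial_v\theta_t|_{t=0}]$, is injective. 4. Write endomorphisms of $TW_2$ over $U\cap V$ as $3\times3$ matrices in the frame $\partial_z,\partial_{u_1},\partial_{u_2}$ acting on column vectors, and let $E_{rs}$ be the matrix whose only nonzero entry is a $1$ in row $r$ and column $s$. Then $H^1(W_2,\mathrm{End}(TW_2))$ is generated by the holomorphic cocycles $$z^{-1}u_1u_2^k\,E_{21},\qquad z^{-i}u_2^k\,E_{21}\ (i=1,2,3),\qquad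 z^{-1}u_2^k\,E_{23},\qquad z^{-1}u_2^k\,E_{31}\qquad(k\ge 0),$$ in the sense that every class is represented by a cocycle that is the sum of a series of complex multiples of them, unconditionally convergent at every point of $U\cap V$. -/

import Mathlib

open scoped Manifold ContDiff Topology
open Bundle

noncomputable section

namespace LocalCY

/-! ### The threefold `W₂ = Tot(𝒪(-2) ⊕ 𝒪)` over the projective line -/

/-- The coordinate space `ℂ³`, with coordinates numbered `0, 1, 2`: `(z, u₁, u₂)` on the chart `U`
and `(ξ, v₁, v₂)` on the chart `V`. -/
abbrev C3 : Type := Fin 3 → ℂ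

/-- The change of coordinates `(z, u₁, u₂) ↦ (ξ, v₁, v₂) = (z⁻¹, z² u₁, u₂)`, meaningful where
`z ≠ 0`. It is an involution, so that the inverse change of coordinates has the same formula. -/
def tau (x : C3) : C3 := ![(x 0)⁻¹, (x 0) ^ 2 * x 1, x 2]

@[simp] lemma tau_zero (x : C3) : tau x 0 = (x 0)⁻¹ := rfl
@[simp] lemma tau_one (x : C3) : tau x 1 = (x 0) ^ 2 * x 1 := rfl
@[simp] lemma tau_two (x : C3) : tau x 2 = x 2 := rfl

lemma tau_tau {x : C3} (hx : x 0 ≠ 0) : tau (tau x) = x := by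
  funext i
  fin_cases i <;> (simp [tau]; try field_simp)

/-- The gluing relation on the disjoint union of the two copies of `ℂ³`. -/
def glue : C3 ⊕ C3 → C3 ⊕ C3 → Prop
  | Sum.inl x, Sum.inl y => x = y
  | Sum.inr x, Sum.inr y => x = y
  | Sum.inl x, Sum.inr y => x 0 ≠ 0 ∧ y = tau x
  | Sum.inr x, Sum.inl y => x 0 ≠ 0 ∧ y = tau x

lemma glue_symm {a b : C3 ⊕ C3} (h : glue a b) : glue b a := by
  rcases a with x | x <;> rcases b with y | y
  · exact Eq.symm h
  · obtain ⟨h0, rfl⟩ := h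
    exact ⟨by simpa using h0, (tau_tau h0).symm⟩
  · obtain ⟨h0, rfl⟩ := h
    exact ⟨by simpa using h0, (tau_tau h0).symm⟩
  · exact Eq.symm h

lemma glue_trans {a b c : C3 ⊕ C3} (h : glue a b) (h' : glue b c) : glue a c := by
  rcases a with x | x <;> rcases b with y | y <;> rcases c with w | w
  · exact Eq.trans h h'
  · obtain rfl : x = y := h
    exact h'
  · obtain ⟨h0, rfl⟩ := h
    obtain ⟨-, rfl⟩ := h'
    exact (tau_tau h0).symm
  · obtain rfl : y = w := h'
    exact h
  · obtain rfl : y = w := h'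
    exact h
  · obtain ⟨h0, rfl⟩ := h
    obtain ⟨-, rfl⟩ := h'
    exact (tau_tau h0).symm
  · obtain rfl : x = y := h
    exact h'
  · exact Eq.trans h h'

/-- The gluing relation as an equivalence relation. -/
def glueSetoid : Setoid (C3 ⊕ C3) where
  r := glue
  iseqv :=
    { refl := fun a => by cases a <;> rfl
      symm := glue_symm
      trans := glue_trans }

/-- The threefold `W₂`: two copies of `ℂ³`, glued by
`(ξ, v₁, v₂) = (z⁻¹, z² u₁, u₂)` over `(ℂ ∖ {0}) × ℂ²`. -/
def W2 : Type := Quotient glueSetoid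

/-- The point of `W₂` with coordinates `(z, u₁, u₂)` in the chart `U`. -/
def ptU (x : C3) : W2 := Quotient.mk glueSetoid (Sum.inl x)

/-- The point of `W₂` with coordinates `(ξ, v₁, v₂)` in the chart `V`. -/
def ptV (x : C3) : W2 := Quotient.mk glueSetoid (Sum.inr x)

lemma ptU_eq_ptV_iff {x y : C3} : ptU x = ptV y ↔ x 0 ≠ 0 ∧ y = tau x :=
  Quotient.eq (r := glueSetoid)

lemma ptU_eq_ptV {x : C3} (hx : x 0 ≠ 0) : ptU x = ptV (tau x) :=
  ptU_eq_ptV_iff.2 ⟨hx, rfl⟩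

lemma ptV_eq_ptU {x : C3} (hx : x 0 ≠ 0) : ptV x = ptU (tau x) :=
  (Quotient.eq (r := glueSetoid)).2 ⟨hx, rfl⟩

lemma exists_rep (p : W2) : (∃ x, ptU x = p) ∨ ∃ x, ptV x = p := by
  induction p using Quotient.inductionOn with
  | h a => rcases a with x | x
           · exact Or.inl ⟨x, rfl⟩
           · exact Or.inr ⟨x, rfl⟩

/-- The coordinates `(z, u₁, u₂)`; a junk value outside `U`. -/
def coordU : W2 → C3 :=
  Quotient.lift (Sum.elim id tau) (by
    intro a b h
    rcases a with x | x <;> rcases b with y | y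
    · exact h
    · obtain ⟨h0, rfl⟩ := h
      exact (tau_tau h0).symm
    · obtain ⟨h0, rfl⟩ := h
      rfl
    · exact congrArg tau h)

/-- The coordinates `(ξ, v₁, v₂)`; a junk value outside `V`. -/
def coordV : W2 → C3 :=
  Quotient.lift (Sum.elim tau id) (by
    intro a b h
    rcases a with x | x <;> rcases b with y | y
    · exact congrArg tau h
    · obtain ⟨h0, rfl⟩ := h
      rfl
    · obtain ⟨h0, rfl⟩ := h
      exact (tau_tau h0).symm
    · exact h)

@[simp] lemma coordU_ptU (x : C3) : coordU (ptU x) = x := rfl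
@[simp] lemma coordU_ptV (x : C3) : coordU (ptV x) = tau x := rfl
@[simp] lemma coordV_ptV (x : C3) : coordV (ptV x) = x := rfl
@[simp] lemma coordV_ptU (x : C3) : coordV (ptU x) = tau x := rfl

/-- The chart `U ≅ ℂ³`. -/
def chartU : PartialEquiv W2 C3 where
  toFun := coordU
  invFun := ptU
  source := Set.range ptU
  target := Set.univ
  map_source' _ _ := Set.mem_univ _
  map_target' x _ := Set.mem_range_self x
  left_inv' := by rintro _ ⟨x, rfl⟩; rfl
  right_inv' _ _ := rfl

/-- The chart `V ≅ ℂ³`. -/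
def chartV : PartialEquiv W2 C3 where
  toFun := coordV
  invFun := ptV
  source := Set.range ptV
  target := Set.univ
  map_source' _ _ := Set.mem_univ _
  map_target' x _ := Set.mem_range_self x
  left_inv' := by rintro _ ⟨x, rfl⟩; rfl
  right_inv' _ _ := rfl

lemma ptU_mem_range_ptV {x : C3} : ptU x ∈ Set.range ptV ↔ x 0 ≠ 0 :=
  ⟨fun ⟨_, hy⟩ => (ptU_eq_ptV_iff.1 hy.symm).1, fun h => ⟨_, (ptU_eq_ptV h).symm⟩⟩

lemma ptV_mem_range_ptU {x : C3} : ptV x ∈ Set.range ptU ↔ x 0 ≠ 0 := by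
  refine ⟨fun ⟨y, hy⟩ => ?_, fun h => ⟨_, (ptV_eq_ptU h).symm⟩⟩
  obtain ⟨h0, rfl⟩ := ptU_eq_ptV_iff.1 hy
  simpa using h0

lemma isOpen_ne : IsOpen {x : C3 | x 0 ≠ 0} :=
  isOpen_ne_fun (continuous_apply 0) continuous_const

lemma contDiffOn_tau : ContDiffOn ℂ ω tau {x : C3 | x 0 ≠ 0} := by
  rw [contDiffOn_pi]
  intro i
  have h (j : Fin 3) : ContDiffOn ℂ ω (fun x : C3 => x j) {x : C3 | x 0 ≠ 0} :=
    (contDiff_apply ℂ ℂ j).contDiffOn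
  fin_cases i
  · exact (h 0).inv fun x hx => hx
  · exact ((h 0).pow 2).mul (h 1)
  · exact h 2

lemma source_UV : (chartU.symm.trans chartV).source = {x : C3 | x 0 ≠ 0} := by
  ext x
  simp only [PartialEquiv.trans_source, PartialEquiv.symm_source, Set.mem_inter_iff,
    Set.mem_preimage]
  exact ⟨fun h => ptU_mem_range_ptV.1 h.2, fun h => ⟨Set.mem_univ _, ptU_mem_range_ptV.2 h⟩⟩

lemma source_VU : (chartV.symm.trans chartU).source = {x : C3 | x 0 ≠ 0} := by
  ext x
  simp only [PartialEquiv.trans_source, PartialEquiv.symm_source, Set.mem_inter_iff,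
    Set.mem_preimage]
  exact ⟨fun h => ptV_mem_range_ptU.1 h.2, fun h => ⟨Set.mem_univ _, ptV_mem_range_ptU.2 h⟩⟩

/-- The two charts are compatible: their changes of coordinates are holomorphic on open sets. -/
lemma chart_compat (e e' : PartialEquiv W2 C3) (he : e ∈ ({chartU, chartV} : Set _))
    (he' : e' ∈ ({chartU, chartV} : Set _)) :
    IsOpen (e.symm.trans e').source ∧
      ContDiffOn ℂ ω (e.symm.trans e') (e.symm.trans e').source := by
  rcases he with rfl | rfl <;> rcases he' with rfl | rfl
  · have h : (chartU.symm.trans chartU).source = Set.univ := by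
      ext x
      exact ⟨fun _ => Set.mem_univ _, fun _ => ⟨Set.mem_univ _, Set.mem_range_self x⟩⟩
    rw [h]
    exact ⟨isOpen_univ, contDiff_id.contDiffOn⟩
  · rw [source_UV]
    exact ⟨isOpen_ne, contDiffOn_tau⟩
  · rw [source_VU]
    exact ⟨isOpen_ne, contDiffOn_tau⟩
  · have h : (chartV.symm.trans chartV).source = Set.univ := by
      ext x
      exact ⟨fun _ => Set.mem_univ _, fun _ => ⟨Set.mem_univ _, Set.mem_range_self x⟩⟩
    rw [h]
    exact ⟨isOpen_univ, contDiff_id.contDiffOn⟩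

open Classical in
/-- The atlas `{U, V}` of `W₂`. -/
def w2Core : ChartedSpaceCore C3 W2 where
  atlas := {chartU, chartV}
  chartAt p := if p ∈ Set.range ptU then chartU else chartV
  mem_chart_source p := by
    by_cases h : p ∈ Set.range ptU
    · rw [if_pos h]; exact h
    · rw [if_neg h]; exact (exists_rep p).resolve_left h
  chart_mem_atlas p := by
    by_cases h : p ∈ Set.range ptU <;> simp [h]
  open_source e e' he he' := (chart_compat e e' he he').1
  continuousOn_toFun e e' he he' := (chart_compat e e' he he').2.continuousOn

instance : TopologicalSpace W2 := w2Core.toTopologicalSpace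

instance : ChartedSpace C3 W2 := w2Core.toChartedSpace

/-- `W₂` is a complex manifold of dimension three. -/
instance : IsManifold 𝓘(ℂ, C3) ω W2 := by
  refine isManifold_of_contDiffOn 𝓘(ℂ, C3) ω W2 ?_
  intro e e' he he'
  obtain ⟨f, hf, hef⟩ : ∃ f, ∃ h : f ∈ w2Core.atlas, e = w2Core.openPartialHomeomorph f h := by
    have h : e ∈ ⋃ (e : PartialEquiv W2 C3) (he : e ∈ w2Core.atlas),
      {w2Core.openPartialHomeomorph e he} := he
    simpa using h
  obtain ⟨f', hf', hef'⟩ :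
      ∃ f, ∃ h : f ∈ w2Core.atlas, e' = w2Core.openPartialHomeomorph f h := by
    have h : e' ∈ ⋃ (e : PartialEquiv W2 C3) (he : e ∈ w2Core.atlas),
      {w2Core.openPartialHomeomorph e he} := he'
    simpa using h
  subst hef hef'
  have key := (chart_compat f f' hf hf').2
  refine key.mono ?_
  intro x hx
  exact hx.1

/-- The open set `U ⊆ W₂`. -/
def U : TopologicalSpace.Opens W2 :=
  ⟨Set.range ptU, w2Core.open_source' (e := chartU) (Or.inl rfl)⟩

/-- The open set `V ⊆ W₂`. -/
def V : TopologicalSpace.Opens W2 :=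
  ⟨Set.range ptV, w2Core.open_source' (e := chartV) (Or.inr rfl)⟩

/-! ### The endomorphism bundle of the tangent bundle and its first Čech cohomology -/

/-- The holomorphic tangent space of `W₂` at `p`. -/
abbrev T (p : W2) : Type := TangentSpace 𝓘(ℂ, C3) p

/-- The fibre at `p` of the bundle `End(TW₂)`. -/
abbrev EndT (p : W2) : Type := T p →L[ℂ] T p

open Classical in
/-- Extension by zero of a section over `O`. -/
def extend {O : TopologicalSpace.Opens W2} (s : ∀ p : O, EndT p) (p : W2) : EndT p :=
  if h : p ∈ O then s ⟨p, h⟩ else 0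

/-- `s` is a holomorphic section of `End(TW₂)` over the open set `O`. -/
def IsHolSection (O : TopologicalSpace.Opens W2) (s : ∀ p : O, EndT p) : Prop :=
  MDifferentiableOn 𝓘(ℂ, C3) (𝓘(ℂ, C3).prod 𝓘(ℂ, C3 →L[ℂ] C3))
    (fun p : W2 => TotalSpace.mk' (C3 →L[ℂ] C3) (E := EndT) p (extend s p)) O

/-- The space `Γ(O, End(TW₂))` of holomorphic sections over `O`. -/
def sections (O : TopologicalSpace.Opens W2) : Submodule ℂ (∀ p : O, EndT p) where
  carrier := {s | IsHolSection O s}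
  zero_mem' := by
    have h : extend (0 : ∀ p : O, EndT p) = 0 := by
      funext p; simp [extend]
    simp only [Set.mem_ofPred_eq, IsHolSection, h]
    exact mdifferentiableOn_zeroSection ℂ EndT
  add_mem' := by
    intro s t hs ht
    have h : extend (s + t) = extend s + extend t := by
      funext p
      by_cases hp : p ∈ O <;> simp [extend, hp]
    simp only [Set.mem_ofPred_eq, IsHolSection, h] at hs ht ⊢
    exact mdifferentiableOn_add_section hs ht
  smul_mem' := by
    intro c s hs
    have h : extend (c • s) = c • extend s := by
      funext p
      by_cases hp : p ∈ O <;> simp [extend, hp]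
    simp only [Set.mem_ofPred_eq, IsHolSection, h] at hs ⊢
    exact MDifferentiableOn.smul_const_section hs

/-- Restriction of holomorphic sections to a smaller open set. -/
def res {O O' : TopologicalSpace.Opens W2} (h : O' ≤ O) : sections O →ₗ[ℂ] sections O' where
  toFun s := ⟨fun p => s.1 ⟨p.1, h p.2⟩, by
    refine (MDifferentiableOn.mono s.2 h).congr ?_
    intro p hp
    have hp' : p ∈ O' := hp
    simp [extend, hp', h hp']⟩
  map_add' _ _ := rfl
  map_smul' _ _ := rfl

/-- The Čech differential `(a, b) ↦ b|_{U ∩ V} - a|_{U ∩ V}` from `0`-cochains to `1`-cochains of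
`End(TW₂)` for the covering of `W₂` by `U` and `V`. -/
def cechD : (sections U × sections V) →ₗ[ℂ] sections (U ⊓ V) :=
  (res inf_le_right).comp (LinearMap.snd ℂ _ _) - (res inf_le_left).comp (LinearMap.fst ℂ _ _)

/-- `H¹(W₂, End(TW₂))`, computed by the Čech complex of the covering `{U, V}`: as there are no
triple intersections every section over `U ∩ V` is a `1`-cocycle. -/
abbrev H1 : Type := sections (U ⊓ V) ⧸ LinearMap.range cechD

/-- The class in `H¹(W₂, End(TW₂))` of a cocycle. -/
def cls : sections (U ⊓ V) →ₗ[ℂ] H1 := (LinearMap.range cechD).mkQ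

/-! ### The Zariski tangent space of the moduli at `TW₂` -/

/-- A holomorphic automorphism of `TW₂[ε] = TW₂ ⊗ ℂ[ε]` over `O`, where `ε² = 0`, that reduces to
the identity modulo `ε`. -/
structure InfAut (O : TopologicalSpace.Opens W2) where
  /-- The automorphism at each point, an element of `(End T_p W₂)[ε]`. -/
  val : ∀ p : O, DualNumber (EndT p)
  fst_eq : ∀ p, (val p).fst = 1
  snd_hol : IsHolSection O fun p => (val p).snd

/-- A first-order deformation of the holomorphic bundle `TW₂`: a bundle over `W₂ × Spec ℂ[ε]`
that restricts to `TW₂` modulo `ε`, presented by gluing `TW₂[ε]|_U` to `TW₂[ε]|_V` over `U ∩ V` by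
an automorphism that is the identity modulo `ε`. -/
abbrev FirstOrderDeformation : Type := InfAut (U ⊓ V)

/-- The cocycle of a first-order deformation, i.e. the `ε`-part of its gluing. -/
def FirstOrderDeformation.cocycle (g : FirstOrderDeformation) : sections (U ⊓ V) :=
  ⟨fun p => (g.val p).snd, g.snd_hol⟩

/-- Isomorphism of first-order deformations: automorphisms of `TW₂[ε]` over `U` and over `V`,
equal to the identity modulo `ε`, that are compatible with the gluings. -/
def FirstOrderDeformation.Iso (g g' : FirstOrderDeformation) : Prop :=
  ∃ (a : InfAut U) (b : InfAut V), ∀ p : (U ⊓ V : TopologicalSpace.Opens W2),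
    b.val ⟨p.1, p.2.2⟩ * g.val p = g'.val p * a.val ⟨p.1, p.2.1⟩

/-- The Zariski tangent space at `TW₂` of the moduli of holomorphic bundles on `W₂`: the
isomorphism classes of first-order deformations of `TW₂`. -/
def ModuliTangentSpace : Type := Quot FirstOrderDeformation.Iso

/-! ### Holomorphic families of bundles -/

/-- A holomorphic family of bundles `E_t` on `W₂`, parametrised by `t ∈ ℂⁿ`, with `E₀ = TW₂`: the
bundle `E_t` is glued from `TW₂|_U` and `TW₂|_V` by the automorphism `θ t` of `TW₂|_{U ∩ V}`, which
is holomorphic in the parameter and the point together. -/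
structure Family (n : ℕ) where
  /-- The gluing. -/
  θ : (Fin n → ℂ) → ∀ p : (U ⊓ V : TopologicalSpace.Opens W2), EndT p
  hol : MDifferentiableOn (𝓘(ℂ, Fin n → ℂ).prod 𝓘(ℂ, C3))
    (𝓘(ℂ, C3).prod 𝓘(ℂ, C3 →L[ℂ] C3))
    (fun x : (Fin n → ℂ) × W2 =>
      TotalSpace.mk' (C3 →L[ℂ] C3) (E := EndT) x.2 (extend (θ x.1) x.2))
    (Set.univ ×ˢ ((U ⊓ V : TopologicalSpace.Opens W2) : Set W2))
  isUnit : ∀ t p, IsUnit (θ t p)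
  zero : ∀ p, θ 0 p = 1

/-- `κ` is the Kodaira–Spencer map at `t = 0` of the family, on the level of cocycles: `κ v` is the
derivative of the gluing at `t = 0` in the direction `v`. -/
def Family.IsKodairaSpencer {n : ℕ} (𝓔 : Family n) (κ : (Fin n → ℂ) →ₗ[ℂ] sections (U ⊓ V)) :
    Prop :=
  ∀ v p, HasDerivAt (fun s : ℂ => 𝓔.θ (s • v) p) ((κ v).1 p) 0

/-! ### The generators -/

/-- The endomorphism of `T_p W₂` with matrix `M` in the frame `∂/∂z, ∂/∂u₁, ∂/∂u₂` of the chart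
`U` (acting on column vectors). -/
def ofMatrixU (p : W2) (M : Matrix (Fin 3) (Fin 3) ℂ) : EndT p :=
  (mfderiv 𝓘(ℂ, C3) 𝓘(ℂ, C3) ptU (coordU p) : C3 →L[ℂ] C3) ∘L
    (LinearMap.toContinuousLinearMap (Matrix.toLin' M) : C3 →L[ℂ] C3) ∘L
      (mfderiv 𝓘(ℂ, C3) 𝓘(ℂ, C3) coordU p : C3 →L[ℂ] C3)

/-- The matrices of the generating cocycles at `x = (z, u₁, u₂)`. If the nine entries of a matrix
are numbered row by row, the positions used are number 4 (second row, first column), number 6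
(second row, third column) and number 7 (third row, first column). -/
def genMatrix (m : Fin 6) (k : ℕ) (x : C3) : Matrix (Fin 3) (Fin 3) ℂ :=
  match m with
  | 0 => Matrix.single 1 0 ((x 0)⁻¹ * x 1 * x 2 ^ k)
  | 1 => Matrix.single 1 0 ((x 0)⁻¹ * x 2 ^ k)
  | 2 => Matrix.single 1 0 ((x 0 ^ 2)⁻¹ * x 2 ^ k)
  | 3 => Matrix.single 1 0 ((x 0 ^ 3)⁻¹ * x 2 ^ k)
  | 4 => Matrix.single 1 2 ((x 0)⁻¹ * x 2 ^ k)
  | 5 => Matrix.single 2 0 ((x 0)⁻¹ * x 2 ^ k)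

/-- The generating cocycles, as sections of `End(TW₂)` over `U ∩ V`. -/
def gen (i : Fin 6 × ℕ) (p : (U ⊓ V : TopologicalSpace.Opens W2)) : EndT p :=
  ofMatrixU p (genMatrix i.1 i.2 (coordU p))

end LocalCY

end

noncomputable section

namespace LocalCY

/-!
By Laurent expansion in `z`, a function on `U ∩ V` is the sum of a function on `U` and a function
of `(ξ, u₁, u₂)` divisible by `ξ`. In the coordinates of `V`, where `u₁ = ξ² v₁`, the only terms
that extend neither to `U` nor, after multiplication by `zⁿ`, to `V` are `z⁻ᵐ (z² u₁)ᵃ c(u₂)` with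
`m < n` and `2 * a < m`. Passing to the frame of `V` multiplies the entry `E₂₁` by `-z⁴` and the
entries `E₂₃` and `E₃₁` by `±z²`, so these terms obstruct there with `n = 4` and `n = 2`; the other
entries reduce to these three without further obstruction. What remains are the listed generators
with coefficients entire in `u₂`, and Taylor expansion of the coefficients gives the series.

For infinite-dimensionality, suppose `z⁻¹ h(u₂) E₂₃` is a coboundary. Along the line `u₁ = 0` its
`(2, 3)` entry gives `h - z A(z) = z⁻¹ B(z⁻¹)` with `A` and `B` entire, and Liouville's theorem
forces `h = 0`. These cocycles are nilpotent, so `1 + σ` is invertible for each of them; this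
produces the families of bundles.
-/

section ComplexAnalysis

open MeasureTheory Metric Set

lemma exists_ball_forall_norm_lt {X Y F : Type*} [PseudoMetricSpace X] [TopologicalSpace Y]
    [SeminormedAddCommGroup F] {K : X × Y → F} {Ω : Set (X × Y)} (hΩ : IsOpen Ω)
    (hK : ContinuousOn K Ω) {S : Set Y} (hS : IsCompact S) {x₀ : X}
    (hx₀ : ∀ w ∈ S, (x₀, w) ∈ Ω) :
    ∃ ε > 0, ∃ M, ∀ x ∈ ball x₀ ε, ∀ w ∈ S, (x, w) ∈ Ω ∧ ‖K (x, w)‖ < M := by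
  obtain ⟨M, hM⟩ := hS.exists_bound_of_continuousOn
    (hK.comp (f := fun w : Y => (x₀, w)) (by fun_prop) hx₀)
  have hΩM : IsOpen (Ω ∩ K ⁻¹' ball 0 (M + 1)) := hK.isOpen_inter_preimage hΩ isOpen_ball
  obtain ⟨u, v, hu, -, hxu, hSv, huv⟩ := generalized_tube_lemma
    (isCompact_singleton (x := x₀)) hS hΩM (by
      rintro ⟨x, w⟩ ⟨rfl, hw⟩
      exact ⟨hx₀ w hw, mem_ball_zero_iff.2 ((hM w hw).trans_lt (lt_add_one M))⟩)
  obtain ⟨ε, hε, hεu⟩ := Metric.mem_nhds_iff.1 (hu.mem_nhds (hxu rfl))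
  refine ⟨ε, hε, M + 1, fun x hx w hw => ?_⟩
  have hxw := huv (mk_mem_prod (hεu hx) (hSv hw))
  exact ⟨hxw.1, mem_ball_zero_iff.1 hxw.2⟩

variable {E : Type*} [NormedAddCommGroup E] [NormedSpace ℂ E]

lemma aestronglyMeasurable_fderiv_circleMap [FiniteDimensional ℂ E] (K : E × ℂ → ℂ) (x₀ : E)
    (R : ℝ) (μ : Measure ℝ) :
    AEStronglyMeasurable (fun θ : ℝ => deriv (circleMap 0 R) θ •
      (fderiv ℂ K (x₀, circleMap 0 R θ)).comp (ContinuousLinearMap.inl ℂ E ℂ)) μ := by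
  borelize E
  have : ProperSpace E := FiniteDimensional.proper ℂ E
  have hfderiv : Measurable fun θ : ℝ => fderiv ℂ K (x₀, circleMap 0 R θ) :=
    (measurable_fderiv ℂ K).comp (by fun_prop)
  have hcomp : Continuous fun L : E × ℂ →L[ℂ] ℂ => L.comp (ContinuousLinearMap.inl ℂ E ℂ) := by
    fun_prop
  have hderiv : Continuous (deriv (circleMap (0 : ℂ) R)) := by
    simp only [funext fun θ => deriv_circleMap (0 : ℂ) R θ]
    fun_prop
  exact hderiv.aestronglyMeasurable.smul
    (hcomp.comp_aestronglyMeasurable hfderiv.aestronglyMeasurable)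

lemma differentiableAt_circleIntegral [FiniteDimensional ℂ E] {K : E × ℂ → ℂ} {Ω : Set (E × ℂ)}
    (hΩ : IsOpen Ω) (hK : DifferentiableOn ℂ K Ω) {R : ℝ} (hR : 0 < R) {x₀ : E}
    (hx₀ : ∀ w ∈ sphere (0 : ℂ) R, (x₀, w) ∈ Ω) :
    DifferentiableAt ℂ (fun x => ∮ w in C(0, R), K (x, w)) x₀ := by
  obtain ⟨ε, hε, M, hM⟩ := exists_ball_forall_norm_lt hΩ hK.continuousOn
    (isCompact_sphere (0 : ℂ) R) hx₀
  have hmem (θ : ℝ) : circleMap 0 R θ ∈ sphere (0 : ℂ) R := circleMap_mem_sphere 0 hR.le θ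
  have hderivMap : Continuous (deriv (circleMap (0 : ℂ) R)) := by
    simp only [funext fun θ => deriv_circleMap (0 : ℂ) R θ]
    fun_prop
  have hcont : ∀ x ∈ ball x₀ ε,
      Continuous fun θ => deriv (circleMap 0 R) θ • K (x, circleMap 0 R θ) := fun x hx =>
    hderivMap.smul (hK.continuousOn.comp_continuous (by fun_prop) fun θ => (hM x hx _ (hmem θ)).1)
  have hderiv (θ : ℝ) : HasFDerivAt (fun x => K (x, circleMap 0 R θ))
      ((fderiv ℂ K (x₀, circleMap 0 R θ)).comp (ContinuousLinearMap.inl ℂ E ℂ)) x₀ :=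
    HasFDerivAt.comp (f := fun x : E => (x, circleMap 0 R θ)) x₀
      (hK.differentiableAt (hΩ.mem_nhds (hx₀ _ (hmem θ)))).hasFDerivAt
      (hasFDerivAt_prodMk_left x₀ (circleMap 0 R θ))
  -- Cauchy's estimate turns the bound `M` on `K` into a Lipschitz bound that is uniform in `θ`.
  have hlip (θ : ℝ) (x : E) (hx : x ∈ ball x₀ ε) :
      ‖K (x, circleMap 0 R θ) - K (x₀, circleMap 0 R θ)‖ ≤ 2 * M / ε * ‖x - x₀‖ := by
    rw [← dist_eq_norm, ← dist_eq_norm]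
    refine Complex.dist_le_div_mul_dist_of_mapsTo_ball
      (f := fun x => K (x, circleMap 0 R θ)) (hK.comp (by fun_prop) fun y hy =>
        (hM y hy _ (hmem θ)).1) (fun y hy => ?_) hx
    rw [mem_closedBall]
    linarith [dist_le_norm_add_norm (K (y, circleMap 0 R θ)) (K (x₀, circleMap 0 R θ)),
      (hM y hy _ (hmem θ)).2, (hM x₀ (mem_ball_self hε) _ (hmem θ)).2]
  have hasFDerivAt := hasFDerivAt_integral_of_dominated_loc_of_lip' (𝕜 := ℂ)
    (F := fun x θ => deriv (circleMap 0 R) θ • K (x, circleMap 0 R θ))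
    (bound := fun _ => R * (2 * M / ε)) (ball_mem_nhds x₀ hε)
    (fun x hx => (hcont x hx).aestronglyMeasurable)
    (hcont x₀ (mem_ball_self hε)).integrableOn_Ioc
    (aestronglyMeasurable_fderiv_circleMap K x₀ R (volume.restrict (Ioc 0 (2 * Real.pi))))
    (.of_forall fun θ x hx => by
      rw [← smul_sub, norm_smul, mul_assoc]
      simpa [abs_of_pos hR] using mul_le_mul_of_nonneg_left (hlip θ x hx) hR.le)
    (integrable_const _) (.of_forall fun θ => (hderiv θ).fun_const_smul _)
  simpa only [circleIntegral, intervalIntegral.integral_of_le Real.two_pi_pos.le]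
    using hasFDerivAt.2.differentiableAt

lemma circleIntegral_eq_of_differentiableOn {s : Set ℂ} (hs : IsOpen s) {f : ℂ → ℂ}
    (hf : DifferentiableOn ℂ f s) {r R : ℝ} (hr : 0 < r) (hrR : r ≤ R)
    (hsub : ∀ w : ℂ, ‖w‖ ∈ Icc r R → w ∈ s) :
    ∮ w in C(0, R), f w = ∮ w in C(0, r), f w := by
  refine Complex.circleIntegral_eq_of_differentiable_on_annulus_off_countable hr hrR
    countable_empty (hf.continuousOn.mono fun w hw => hsub w ?_) fun w hw =>
      hf.differentiableAt (hs.mem_nhds (hsub w ?_))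
  · simp only [mem_sdiff, mem_closedBall, mem_ball, dist_zero_right, not_lt] at hw
    exact ⟨hw.2, hw.1⟩
  · simp only [mem_sdiff, mem_closedBall, mem_ball, dist_zero_right, not_le] at hw
    exact ⟨hw.1.2.le, hw.1.1.le⟩

lemma exists_differentiable_eq_circleIntegral [FiniteDimensional ℂ E] {K : E × ℂ → ℂ}
    {Ω : Set (E × ℂ)} (hΩ : IsOpen Ω) (hK : DifferentiableOn ℂ K Ω) {I : E → Set ℝ}
    (hIopen : IsOpen {p : E × ℝ | p.2 ∈ I p.1}) (hIne : ∀ x, (I x).Nonempty)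
    (hIconn : ∀ x, (I x).OrdConnected) (hIpos : ∀ x, ∀ R ∈ I x, 0 < R)
    (hIΩ : ∀ x w, ‖w‖ ∈ I x → (x, w) ∈ Ω) :
    ∃ Φ : E → ℂ, Differentiable ℂ Φ ∧ ∀ x, ∀ R ∈ I x, Φ x = ∮ w in C(0, R), K (x, w) := by
  have hslice (x : E) : Continuous fun w : ℂ => (x, w) := by fun_prop
  have hindep (x : E) : ∀ r ∈ I x, ∀ R ∈ I x, r ≤ R →
      ∮ w in C(0, R), K (x, w) = ∮ w in C(0, r), K (x, w) := fun r hr R hR hrR =>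
    circleIntegral_eq_of_differentiableOn (hΩ.preimage (hslice x))
      (hK.comp (f := fun w : ℂ => (x, w)) (by fun_prop) fun w hw => hw) (hIpos x r hr) hrR
      fun w hw => hIΩ x w ((hIconn x).out hr hR hw)
  choose ρ hρ using hIne
  have heq (x : E) (R : ℝ) (hR : R ∈ I x) :
      ∮ w in C(0, ρ x), K (x, w) = ∮ w in C(0, R), K (x, w) :=
    (le_total R (ρ x)).elim (hindep x R hR _ (hρ x)) fun h => (hindep x _ (hρ x) R hR h).symm
  refine ⟨fun x => ∮ w in C(0, ρ x), K (x, w), fun x₀ => ?_, heq⟩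
  have hnear : ∀ᶠ x in nhds x₀, ρ x₀ ∈ I x :=
    (hIopen.preimage (f := fun x => (x, ρ x₀)) (by fun_prop)).mem_nhds (hρ x₀)
  refine (differentiableAt_circleIntegral hΩ hK (hIpos x₀ _ (hρ x₀)) fun w hw =>
    hIΩ x₀ w ?_).congr_of_eventuallyEq (hnear.mono fun x hx => heq x _ hx)
  rw [mem_sphere_zero_iff_norm.1 hw]
  exact hρ x₀

lemma circleIntegral_dslope {f : ℂ → ℂ} {ρ : ℝ} (hρ : 0 < ρ) {z : ℂ} (hz : ‖z‖ ≠ ρ)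
    (hf : ContinuousOn f (sphere 0 ρ)) :
    ∮ w in C(0, ρ), dslope f z w =
      (∮ w in C(0, ρ), f w * (w - z)⁻¹) - f z * ∮ w in C(0, ρ), (w - z)⁻¹ := by
  have hne : ∀ w ∈ sphere (0 : ℂ) ρ, w ≠ z := by
    rintro w hw rfl
    exact hz (mem_sphere_zero_iff_norm.1 hw)
  have hint (h : ℂ → ℂ) (hh : ContinuousOn h (sphere 0 ρ)) :
      CircleIntegrable (fun w => h w * (w - z)⁻¹) 0 ρ :=
    (hh.mul (ContinuousOn.inv₀ (by fun_prop) fun w hw =>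
      sub_ne_zero.2 (hne w hw))).circleIntegrable hρ.le
  rw [← circleIntegral.integral_const_mul,
    ← circleIntegral.integral_sub (hint f hf) (hint _ continuousOn_const)]
  refine circleIntegral.integral_congr hρ.le fun w hw => ?_
  rw [dslope_of_ne _ (hne w hw), slope_def_field]
  ring

lemma circleIntegral_sub_inv_eq_zero {r : ℝ} (hr : 0 < r) {z : ℂ} (hz : r < ‖z‖) :
    ∮ w in C(0, r), (w - z)⁻¹ = 0 := by
  refine DiffContOnCl.circleIntegral_eq_zero hr.le (DifferentiableOn.diffContOnCl ?_)
  rw [closure_ball _ hr.ne']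
  refine DifferentiableOn.inv (by fun_prop) fun w hw => sub_ne_zero.2 ?_
  rintro rfl
  exact hz.not_ge (mem_closedBall_zero_iff.1 hw)

lemma circleIntegral_annulus_sub_inv_mul {f : ℂ → ℂ} (hf : DifferentiableOn ℂ f {0}ᶜ) {r R : ℝ}
    (hr : 0 < r) {z : ℂ} (hrz : r < ‖z‖) (hzR : ‖z‖ < R) :
    (∮ w in C(0, R), f w * (w - z)⁻¹) - ∮ w in C(0, r), f w * (w - z)⁻¹ =
      2 * Real.pi * Complex.I * f z := by
  have hcont {ρ : ℝ} (hρ : 0 < ρ) : ContinuousOn f (sphere 0 ρ) :=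
    hf.continuousOn.mono fun w hw => ne_of_mem_sphere hw hρ.ne'
  have hdslope := circleIntegral_eq_of_differentiableOn isOpen_compl_singleton
    ((Complex.differentiableOn_dslope (isOpen_compl_singleton.mem_nhds
      (norm_pos_iff.1 (hr.trans hrz)))).2 hf) hr (hrz.trans hzR).le
    fun w hw => norm_pos_iff.1 (hr.trans_le hw.1)
  rw [circleIntegral_dslope ((hr.trans hrz).trans hzR) hzR.ne (hcont ((hr.trans hrz).trans hzR)),
    circleIntegral_dslope hr hrz.ne' (hcont hr), circleIntegral_sub_inv_eq_zero hr hrz,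
    circleIntegral.integral_sub_inv_of_mem_ball (mem_ball_zero_iff.2 hzR)] at hdslope
  linear_combination hdslope

lemma exists_differentiable_eq_circleIntegral_mul_sub_inv [FiniteDimensional ℂ E]
    {f : E × ℂ → ℂ} (hf : DifferentiableOn ℂ f {p | p.2 ≠ 0}) :
    ∃ Φ : E × ℂ → ℂ, Differentiable ℂ Φ ∧ ∀ x z (R : ℝ), ‖z‖ < R →
      Φ (x, z) = ∮ w in C(0, R), f (x, w) * (w - z)⁻¹ := by
  let Ω : Set ((E × ℂ) × ℂ) := {p | p.2 ≠ 0 ∧ p.2 - p.1.2 ≠ 0}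
  have hΩ : IsOpen Ω := (isOpen_ne_fun (by fun_prop) (by fun_prop)).inter
    (isOpen_ne_fun (by fun_prop) (by fun_prop))
  have hK : DifferentiableOn ℂ (fun p : (E × ℂ) × ℂ => f (p.1.1, p.2) * (p.2 - p.1.2)⁻¹) Ω :=
    (hf.comp (by fun_prop) fun p hp => hp.1).mul
      (DifferentiableOn.inv (by fun_prop) fun p hp => hp.2)
  have hI : IsOpen {p : (E × ℂ) × ℝ | ‖p.1.2‖ < p.2} := isOpen_lt (by fun_prop) (by fun_prop)
  obtain ⟨Φ, hΦ, hΦeq⟩ := exists_differentiable_eq_circleIntegral hΩ hK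
    (I := fun x => Ioi ‖x.2‖) hI (fun _ => nonempty_Ioi) (fun _ => ordConnected_Ioi)
    (fun x R hR => (norm_nonneg _).trans_lt hR) fun x w hw =>
      ⟨norm_pos_iff.1 ((norm_nonneg _).trans_lt hw),
        sub_ne_zero.2 fun h => (mem_Ioi.1 hw).ne' (congrArg norm h)⟩
  exact ⟨Φ, hΦ, fun x z => hΦeq (x, z)⟩

lemma exists_differentiable_eq_circleIntegral_mul_one_sub_inv [FiniteDimensional ℂ E]
    {f : E × ℂ → ℂ} (hf : DifferentiableOn ℂ f {p | p.2 ≠ 0}) :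
    ∃ Φ : E × ℂ → ℂ, Differentiable ℂ Φ ∧ ∀ x ξ (R : ℝ), 0 < R → ‖ξ‖ * R < 1 →
      Φ (x, ξ) = ∮ w in C(0, R), f (x, w) * (1 - ξ * w)⁻¹ := by
  let Ω : Set ((E × ℂ) × ℂ) := {p | p.2 ≠ 0 ∧ 1 - p.1.2 * p.2 ≠ 0}
  have hΩ : IsOpen Ω := (isOpen_ne_fun (by fun_prop) (by fun_prop)).inter
    (isOpen_ne_fun (by fun_prop) (by fun_prop))
  have hK : DifferentiableOn ℂ
      (fun p : (E × ℂ) × ℂ => f (p.1.1, p.2) * (1 - p.1.2 * p.2)⁻¹) Ω :=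
    (hf.comp (by fun_prop) fun p hp => hp.1).mul
      (DifferentiableOn.inv (by fun_prop) fun p hp => hp.2)
  have hI : IsOpen {p : (E × ℂ) × ℝ | 0 < p.2 ∧ ‖p.1.2‖ * p.2 < 1} :=
    (isOpen_lt (by fun_prop) (by fun_prop)).and (isOpen_lt (by fun_prop) (by fun_prop))
  obtain ⟨Φ, hΦ, hΦeq⟩ := exists_differentiable_eq_circleIntegral hΩ hK
    (I := fun x => {R | 0 < R ∧ ‖x.2‖ * R < 1}) hI
    (fun x => ⟨(‖x.2‖ + 1)⁻¹, by positivity, by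
      rw [mul_inv_lt_iff₀ (by positivity)]; linarith⟩)
    (fun x => ⟨fun r hr R hR t ht => ⟨hr.1.trans_le ht.1,
      (mul_le_mul_of_nonneg_left ht.2 (norm_nonneg _)).trans_lt hR.2⟩⟩)
    (fun x R hR => hR.1) fun x w hw => ⟨norm_pos_iff.1 hw.1, sub_ne_zero.2 fun h => by
      simpa [← norm_mul, ← h] using hw.2⟩
  exact ⟨Φ, hΦ, fun x ξ R hR hξ => hΦeq (x, ξ) R ⟨hR, hξ⟩⟩

theorem exists_laurent_decomposition [FiniteDimensional ℂ E] {f : E × ℂ → ℂ}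
    (hf : DifferentiableOn ℂ f {p | p.2 ≠ 0}) :
    ∃ P g : E × ℂ → ℂ, Differentiable ℂ P ∧ Differentiable ℂ g ∧
      ∀ x z, z ≠ 0 → f (x, z) = P (x, z) + z⁻¹ * g (x, z⁻¹) := by
  obtain ⟨Φ, hΦ, hΦeq⟩ := exists_differentiable_eq_circleIntegral_mul_sub_inv hf
  obtain ⟨Ψ, hΨ, hΨeq⟩ := exists_differentiable_eq_circleIntegral_mul_one_sub_inv hf
  refine ⟨fun p => (2 * Real.pi * Complex.I)⁻¹ * Φ p, fun p => (2 * Real.pi * Complex.I)⁻¹ * Ψ p,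
    hΦ.const_mul _, hΨ.const_mul _, fun x z hz => ?_⟩
  have hz' : 0 < ‖z‖ := norm_pos_iff.2 hz
  have hΨz : z⁻¹ * Ψ (x, z⁻¹) = -∮ w in C(0, ‖z‖ / 2), f (x, w) * (w - z)⁻¹ := by
    rw [hΨeq x z⁻¹ (‖z‖ / 2) (by positivity) (by rw [norm_inv]; field_simp; norm_num),
      neg_eq_neg_one_mul, ← circleIntegral.integral_const_mul, ← circleIntegral.integral_const_mul]
    refine circleIntegral.integral_congr (by positivity) fun w _ => ?_
    simp only [show 1 - z⁻¹ * w = -(z⁻¹ * (w - z)) by field_simp; ring, inv_neg, mul_inv, inv_inv]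
    field_simp
  have hcauchy := circleIntegral_annulus_sub_inv_mul (f := fun w => f (x, w))
    (hf.comp (by fun_prop) fun w hw => hw) (half_pos hz') (half_lt_self hz') (lt_add_one ‖z‖)
  rw [← hΦeq x z _ (lt_add_one _), sub_eq_add_neg, ← hΨz] at hcauchy
  rw [← mul_right_inj' Complex.two_pi_I_ne_zero, ← hcauchy]
  field_simp

lemma apply_eq_of_eq_comp_inv {F : Type*} [NormedAddCommGroup F] [NormedSpace ℂ F] {f g : ℂ → F}
    (hf : Differentiable ℂ f) (hg : ContinuousAt g 0) (hfg : ∀ z ≠ 0, f z = g z⁻¹) (z : ℂ) :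
    f z = g 0 := by
  refine hf.apply_eq_of_tendsto_cocompact z ?_
  have hinv : Filter.Tendsto (fun z : ℂ => g z⁻¹) (Filter.cocompact ℂ) (𝓝 (g 0)) := by
    rw [← Metric.cobounded_eq_cocompact]
    exact hg.tendsto.comp Filter.tendsto_inv₀_cobounded
  refine hinv.congr' ?_
  filter_upwards [(isCompact_singleton (x := (0 : ℂ))).compl_mem_cocompact] with w hw
  exact (hfg w hw).symm

lemma exists_eq_apply_zero_add_mul [FiniteDimensional ℂ E] {f : E × ℂ → ℂ}
    (hf : Differentiable ℂ f) :
    ∃ q : E × ℂ → ℂ, Differentiable ℂ q ∧ ∀ x w, f (x, w) = f (x, 0) + w * q (x, w) := by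
  obtain ⟨P, g, hP, hg, hPg⟩ := exists_laurent_decomposition (f := fun p => f p * p.2⁻¹)
    (hf.differentiableOn.mul (DifferentiableOn.inv (by fun_prop) fun p hp => hp))
  refine ⟨P, hP, fun x w => ?_⟩
  -- By Liouville, the principal part of `f (x, w) / w` is `f (x, 0) / w`.
  have hconst := apply_eq_of_eq_comp_inv (f := fun w => f (x, w) - w * P (x, w))
    (g := fun ξ => g (x, ξ)) (by fun_prop) (hg.continuous.comp (by fun_prop)).continuousAt
    fun z hz => by
      linear_combination z * hPg x z hz - (f (x, z) - g (x, z⁻¹)) * mul_inv_cancel₀ hz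
  linear_combination hconst w - hconst 0

lemma exists_eq_sum_range_pow_mul_add [FiniteDimensional ℂ E] {f : E × ℂ → ℂ}
    (hf : Differentiable ℂ f) (N : ℕ) :
    ∃ (c : ℕ → E → ℂ) (r : E × ℂ → ℂ), (∀ a, Differentiable ℂ (c a)) ∧ Differentiable ℂ r ∧
      ∀ x w, f (x, w) = ∑ a ∈ Finset.range N, w ^ a * c a x + w ^ N * r (x, w) := by
  induction N with
  | zero => exact ⟨fun _ _ => 0, f, by fun_prop, hf, by simp⟩
  | succ N ih =>
    obtain ⟨c, r, hc, hr, hfr⟩ := ih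
    obtain ⟨q, hq, hrq⟩ := exists_eq_apply_zero_add_mul hr
    refine ⟨Function.update c N fun x => r (x, 0), q, fun a => ?_, hq, fun x w => ?_⟩
    · rcases eq_or_ne a N with rfl | ha
      · simpa using! hr.comp (f := fun x : E => (x, 0)) (by fun_prop)
      · simpa [Function.update_of_ne ha] using hc a
    · have hcongr : ∀ a ∈ Finset.range N,
          w ^ a * Function.update c N (fun x => r (x, 0)) a x = w ^ a * c a x := fun a ha => by
        rw [Function.update_of_ne (Finset.mem_range.1 ha).ne]
      rw [Finset.sum_range_succ, Finset.sum_congr rfl hcongr, Function.update_self, hfr, hrq]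
      ring

end ComplexAnalysis

section Splitting

@[fun_prop]
lemma differentiable_vecCons {𝕜 E F : Type*} [NontriviallyNormedField 𝕜] [NormedAddCommGroup E]
    [NormedSpace 𝕜 E] [NormedAddCommGroup F] [NormedSpace 𝕜 F] {n : ℕ} {f : E → F}
    {g : E → Fin n → F} (hf : Differentiable 𝕜 f) (hg : Differentiable 𝕜 g) :
    Differentiable 𝕜 fun x => Matrix.vecCons (f x) (g x) :=
  differentiable_pi.2 fun i => Fin.cases hf (differentiable_pi.1 hg) i

lemma exists_inv_pow_mul_comp_tau_eq (m : ℕ) {G : C3 → ℂ} (hG : Differentiable ℂ G) :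
    ∃ (P Q : C3 → ℂ) (c : ℕ → ℂ → ℂ), Differentiable ℂ P ∧ Differentiable ℂ Q ∧
      (∀ a, Differentiable ℂ (c a)) ∧ ∀ x : C3, x 0 ≠ 0 →
        (x 0 ^ m)⁻¹ * G (tau x) = P x +
          ∑ a ∈ Finset.range ((m + 1) / 2), (x 0 ^ m)⁻¹ * tau x 1 ^ a * c a (x 2) +
          (x 0 ^ (m + 1))⁻¹ * Q (tau x) := by
  have hm : m ≤ 2 * ((m + 1) / 2) := by lia
  set N := (m + 1) / 2
  obtain ⟨q, hq, hGq⟩ := exists_eq_apply_zero_add_mul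
    (f := fun p : (ℂ × ℂ) × ℂ => G ![p.2, p.1.1, p.1.2]) (by fun_prop)
  obtain ⟨c, r, hc, hr, hGr⟩ := exists_eq_sum_range_pow_mul_add
    (f := fun p : ℂ × ℂ => G ![0, p.2, p.1]) (by fun_prop) N
  refine ⟨fun x => x 0 ^ (2 * N - m) * x 1 ^ N * r (x 2, x 0 ^ 2 * x 1),
    fun y => q ((y 1, y 2), y 0), c, by fun_prop, by fun_prop, hc, fun x hx => ?_⟩
  -- Terms of order `a ≥ N` in `v₁ = z² u₁` extend to `U`, as `2 * N ≥ m`; terms divisible by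
  -- `ξ = z⁻¹` go to `Q`.
  have hpow : x 0 ^ (2 * N - m) = (x 0 ^ m)⁻¹ * (x 0 ^ 2) ^ N := by
    rw [← pow_mul, pow_sub₀ _ hx hm, mul_comm]
  have htau : tau x = ![(x 0)⁻¹, x 0 ^ 2 * x 1, x 2] := rfl
  simp only [tau_zero, tau_one, tau_two, mul_assoc, ← Finset.mul_sum]
  rw [htau, hGq (x 0 ^ 2 * x 1, x 2), hGr, hpow, pow_succ]
  field_simp
  ring

theorem exists_decomposition_comp_tau (n : ℕ) {f : C3 → ℂ}
    (hf : DifferentiableOn ℂ f {x | x 0 ≠ 0}) :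
    ∃ (P G : C3 → ℂ) (c : ℕ → ℕ → ℂ → ℂ), Differentiable ℂ P ∧ Differentiable ℂ G ∧
      (∀ m a, Differentiable ℂ (c m a)) ∧ ∀ x : C3, x 0 ≠ 0 →
        f x = P x + (∑ m ∈ Finset.range n, ∑ a ∈ Finset.range ((m + 1) / 2),
          (x 0 ^ m)⁻¹ * tau x 1 ^ a * c m a (x 2)) + (x 0 ^ n)⁻¹ * G (tau x) := by
  induction n with
  | zero =>
    obtain ⟨P, g, hP, hg, hfg⟩ := exists_laurent_decomposition
      (f := fun p : (ℂ × ℂ) × ℂ => f ![p.2, p.1.1, p.1.2])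
      (hf.comp (Differentiable.differentiableOn (by fun_prop)) fun p hp => hp)
    refine ⟨fun x => P ((x 1, x 2), x 0), fun y => y 0 * g ((y 0 ^ 2 * y 1, y 2), y 0),
      fun _ _ _ => 0, by fun_prop, by fun_prop, by fun_prop, fun x hx => ?_⟩
    have hx' : x = ![x 0, x 1, x 2] := by ext i; fin_cases i <;> rfl
    have hu : (x 0)⁻¹ ^ 2 * (x 0 ^ 2 * x 1) = x 1 := by field_simp
    simpa only [tau_zero, tau_one, tau_two, hu, ← hx', Finset.range_zero, Finset.sum_empty,
      add_zero, pow_zero, inv_one, one_mul] using hfg (x 1, x 2) (x 0) hx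
  | succ n ih =>
    obtain ⟨P, G, c, hP, hG, hc, hf⟩ := ih
    obtain ⟨P', G', c', hP', hG', hc', hG_eq⟩ := exists_inv_pow_mul_comp_tau_eq n hG
    refine ⟨fun x => P x + P' x, G', Function.update c n c', hP.add hP', hG', fun m a => ?_,
      fun x hx => ?_⟩
    · rcases eq_or_ne m n with rfl | hm
      · simpa using hc' a
      · simpa [Function.update_of_ne hm] using hc m a
    · have hcongr : ∀ m ∈ Finset.range n, Function.update c n c' m = c m := fun m hm =>
        Function.update_of_ne (Finset.mem_range.1 hm).ne _ _
      rw [hf x hx, hG_eq x hx, Finset.sum_range_succ, Function.update_self]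
      simp +contextual only [hcongr]
      ring

end Splitting

section Charts

lemma chartAt_ptU (x : C3) :
    chartAt C3 (ptU x) = w2Core.openPartialHomeomorph chartU (Or.inl rfl) := by
  have : w2Core.chartAt (ptU x) = chartU := if_pos (Set.mem_range_self x)
  change w2Core.openPartialHomeomorph (w2Core.chartAt (ptU x)) _ = _
  congr 1

lemma chartAt_ptV {y : C3} (hy : y 0 = 0) :
    chartAt C3 (ptV y) = w2Core.openPartialHomeomorph chartV (Or.inr rfl) := by
  have : w2Core.chartAt (ptV y) = chartV := if_neg fun h => ptV_mem_range_ptU.1 h hy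
  change w2Core.openPartialHomeomorph (w2Core.chartAt (ptV y)) _ = _
  congr 1

lemma chartAt_ptU_source (x : C3) : (chartAt C3 (ptU x)).source = U := by
  rw [chartAt_ptU]; rfl

lemma chartAt_ptV_source {y : C3} (hy : y 0 = 0) : (chartAt C3 (ptV y)).source = V := by
  rw [chartAt_ptV hy]; rfl

lemma mdifferentiable_ptU : MDifferentiable 𝓘(ℂ, C3) 𝓘(ℂ, C3) ptU := by
  have h := (contMDiffOn_extChartAt_symm (I := 𝓘(ℂ, C3)) (n := 1) (ptU 0)).mdifferentiableOn
    one_ne_zero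
  simp only [extChartAt, chartAt_ptU, mfld_simps] at h
  exact mdifferentiableOn_univ.1 h

lemma mdifferentiable_ptV : MDifferentiable 𝓘(ℂ, C3) 𝓘(ℂ, C3) ptV := by
  have h := (contMDiffOn_extChartAt_symm (I := 𝓘(ℂ, C3)) (n := 1) (ptV 0)).mdifferentiableOn
    one_ne_zero
  simp only [extChartAt, chartAt_ptV (y := 0) rfl, mfld_simps] at h
  exact mdifferentiableOn_univ.1 h

lemma mdifferentiableAt_coordU {p : W2} (hp : p ∈ U) :
    MDifferentiableAt 𝓘(ℂ, C3) 𝓘(ℂ, C3) coordU p := by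
  have h := mdifferentiableAt_extChartAt (I := 𝓘(ℂ, C3)) (x := ptU 0) (y := p)
    (by rwa [chartAt_ptU_source])
  simp only [extChartAt, chartAt_ptU, mfld_simps] at h
  exact h

lemma mdifferentiableAt_coordV {p : W2} (hp : p ∈ V) :
    MDifferentiableAt 𝓘(ℂ, C3) 𝓘(ℂ, C3) coordV p := by
  have h := mdifferentiableAt_extChartAt (I := 𝓘(ℂ, C3)) (x := ptV 0) (y := p)
    (by rwa [chartAt_ptV_source rfl])
  simp only [extChartAt, chartAt_ptV (y := 0) rfl, mfld_simps] at h
  exact h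

lemma ptU_mem_U (x : C3) : ptU x ∈ U := Set.mem_range_self x

lemma ptV_mem_V (x : C3) : ptV x ∈ V := Set.mem_range_self x

lemma ptU_mem_inf {x : C3} : ptU x ∈ U ⊓ V ↔ x 0 ≠ 0 :=
  ⟨fun h => ptU_mem_range_ptV.1 h.2, fun h => ⟨ptU_mem_U x, ptU_mem_range_ptV.2 h⟩⟩

lemma ptU_coordU {p : W2} (hp : p ∈ U) : ptU (coordU p) = p := chartU.left_inv hp

lemma ptV_coordV {p : W2} (hp : p ∈ V) : ptV (coordV p) = p := chartV.left_inv hp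

lemma preimage_ptU_U : ptU ⁻¹' (U : Set W2) = Set.univ := Set.eq_univ_of_forall ptU_mem_U

lemma preimage_ptV_V : ptV ⁻¹' (V : Set W2) = Set.univ := Set.eq_univ_of_forall ptV_mem_V

lemma preimage_ptU_inf :
    ptU ⁻¹' ((U ⊓ V : TopologicalSpace.Opens W2) : Set W2) = {x | x 0 ≠ 0} :=
  Set.ext fun _ => ptU_mem_inf

variable {F : Type*} [NormedAddCommGroup F] [NormedSpace ℂ F]

lemma mdifferentiableOn_iff_ptU {O : TopologicalSpace.Opens W2} (hO : O ≤ U) {f : W2 → F} :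
    MDifferentiableOn 𝓘(ℂ, C3) 𝓘(ℂ, F) f O ↔
      DifferentiableOn ℂ (fun x => f (ptU x)) (ptU ⁻¹' O) := by
  rw [← mdifferentiableOn_iff_differentiableOn]
  refine ⟨fun h => h.comp mdifferentiable_ptU.mdifferentiableOn subset_rfl, fun h => ?_⟩
  refine (MDifferentiableOn.comp (u := ptU ⁻¹' O) h
    (fun p hp => (mdifferentiableAt_coordU (hO hp)).mdifferentiableWithinAt)
    fun p hp => ?_).congr fun p hp => ?_
  · simpa [ptU_coordU (hO hp)] using hp
  · simp [ptU_coordU (hO hp)]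

lemma mdifferentiableOn_iff_ptV {O : TopologicalSpace.Opens W2} (hO : O ≤ V) {f : W2 → F} :
    MDifferentiableOn 𝓘(ℂ, C3) 𝓘(ℂ, F) f O ↔
      DifferentiableOn ℂ (fun y => f (ptV y)) (ptV ⁻¹' O) := by
  rw [← mdifferentiableOn_iff_differentiableOn]
  refine ⟨fun h => h.comp mdifferentiable_ptV.mdifferentiableOn subset_rfl, fun h => ?_⟩
  refine (MDifferentiableOn.comp (u := ptV ⁻¹' O) h
    (fun p hp => (mdifferentiableAt_coordV (hO hp)).mdifferentiableWithinAt)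
    fun p hp => ?_).congr fun p hp => ?_
  · simpa [ptV_coordV (hO hp)] using hp
  · simp [ptV_coordV (hO hp)]

end Charts

section Frames

/-- The identification of `3 × 3` matrices with endomorphisms of `ℂ³`, acting on column vectors. -/
def matrixCLM : Matrix (Fin 3) (Fin 3) ℂ ≃ₐ[ℂ] (C3 →L[ℂ] C3) :=
  Matrix.toLinAlgEquiv'.trans (Module.End.toContinuousLinearMap C3)

lemma matrixCLM_apply (M : Matrix (Fin 3) (Fin 3) ℂ) (v : C3) : matrixCLM M v = M.mulVec v := rfl

lemma matrixCLM_symm_apply (L : C3 →L[ℂ] C3) (i j : Fin 3) :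
    matrixCLM.symm L i j = L (Pi.single j 1) i := by
  conv_rhs => rw [← matrixCLM.apply_symm_apply L]
  rw [matrixCLM_apply, Matrix.mulVec_single_one]
  rfl

lemma differentiableOn_iff_matrixCLM_symm {E : Type*} [NormedAddCommGroup E] [NormedSpace ℂ E]
    {L : E → C3 →L[ℂ] C3} {s : Set E} :
    DifferentiableOn ℂ L s ↔
      ∀ i j, DifferentiableOn ℂ (fun x => matrixCLM.symm (L x) i j) s := by
  simp only [matrixCLM_symm_apply]
  refine ⟨fun h i j => ?_, fun h => ?_⟩
  · exact differentiableOn_pi.1 (h.clm_apply (differentiableOn_const _)) i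
  · have hL : L = fun x => ∑ i, ∑ j, L x (Pi.single j 1) i • matrixCLM (Matrix.single i j 1) := by
      funext x
      conv_lhs => rw [← matrixCLM.apply_symm_apply (L x), Matrix.matrix_eq_sum_single
        (matrixCLM.symm (L x))]
      simp only [map_sum, ← map_smul, Matrix.smul_single, smul_eq_mul, mul_one,
        matrixCLM_symm_apply]
    rw [hL]
    exact .fun_sum fun i _ => .fun_sum fun j _ => (h i j).smul_const _

/-- The Jacobian matrix at `x` of the change of coordinates `tau`. -/
def jacobian (x : C3) : Matrix (Fin 3) (Fin 3) ℂ :=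
  !![-(x 0 ^ 2)⁻¹, 0, 0; 2 * x 0 * x 1, x 0 ^ 2, 0; 0, 0, 1]

lemma jacobian_tau_mul_jacobian {x : C3} (hx : x 0 ≠ 0) : jacobian (tau x) * jacobian x = 1 := by
  ext i j
  fin_cases i <;> fin_cases j <;>
    simp [jacobian, Matrix.mul_apply, Fin.sum_univ_three] <;> field_simp
  ring

lemma hasFDerivAt_tau {x : C3} (hx : x 0 ≠ 0) :
    HasFDerivAt tau (matrixCLM (jacobian x)) x := by
  have hcoord (i : Fin 3) : HasFDerivAt (fun y : C3 => y i) (ContinuousLinearMap.proj i) x :=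
    hasFDerivAt_apply (𝕜 := ℂ) i x
  rw [hasFDerivAt_pi']
  intro i
  fin_cases i
  · refine ((hasDerivAt_inv hx).comp_hasFDerivAt x (hcoord 0)).congr_fderiv ?_
    ext v
    simp [matrixCLM_apply, jacobian, dotProduct, Fin.sum_univ_three]
  · refine (((hcoord 0).pow 2).mul (hcoord 1)).congr_fderiv ?_
    ext v
    simp [matrixCLM_apply, jacobian, dotProduct, Fin.sum_univ_three]
    ring
  · refine (hcoord 2).congr_fderiv ?_
    ext v
    simp [matrixCLM_apply, jacobian, dotProduct, Fin.sum_univ_three]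

/-- The coordinates of an endomorphism of `T_p W₂` in the trivialization around `p₀`. -/
abbrev endCoord (p₀ p : W2) (φ : EndT p) : C3 →L[ℂ] C3 :=
  ContinuousLinearMap.inCoordinates C3 T C3 T p₀ p p₀ p φ

lemma isHolSection_iff_endCoord {O : TopologicalSpace.Opens W2} (p₀ : W2)
    (hO : (O : Set W2) ⊆ (chartAt C3 p₀).source) (s : ∀ p : O, EndT p) :
    IsHolSection O s ↔ MDifferentiableOn 𝓘(ℂ, C3) 𝓘(ℂ, C3 →L[ℂ] C3)
      (fun p => endCoord p₀ p (extend s p)) (O : Set W2) :=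
  Trivialization.mdifferentiableOn_section_iff
    (trivializationAt (C3 →L[ℂ] C3) EndT p₀) O.isOpen fun _ hp => ⟨hO hp, hO hp⟩

lemma endCoord_ptU {p : W2} (hp : p ∈ U) (φ : EndT p) : endCoord (ptU 0) p φ = φ := by
  have hp' : p ∈ (chartAt C3 (ptU 0)).source := by rwa [chartAt_ptU_source]
  have hachart : achart C3 p = achart C3 (ptU 0) := Subtype.ext (by
    rw [coe_achart, coe_achart, ← ptU_coordU hp, chartAt_ptU, chartAt_ptU])
  have hself := (tangentBundleCore 𝓘(ℂ, C3) W2).coordChange_self (achart C3 (ptU 0)) p hp'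
  unfold endCoord ContinuousLinearMap.inCoordinates
  rw [TangentBundle.continuousLinearMapAt_trivializationAt_eq_core hp',
    TangentBundle.symmL_trivializationAt_eq_core hp', hachart]
  ext1 v
  exact (hself _).trans (congrArg φ (hself v))

lemma endCoord_ptV {x : C3} (hx : x 0 ≠ 0) (φ : EndT (ptU x)) :
    endCoord (ptV 0) (ptU x) φ =
      matrixCLM (jacobian x) ∘L (φ : C3 →L[ℂ] C3) ∘L matrixCLM (jacobian (tau x)) := by
  have hp : ptU x ∈ (chartAt C3 (ptV 0)).source := by
    rw [chartAt_ptV_source rfl]; exact ptU_mem_range_ptV.2 hx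
  have hUV : (tangentBundleCore 𝓘(ℂ, C3) W2).coordChange (achart C3 (ptU x)) (achart C3 (ptV 0))
      (ptU x) = matrixCLM (jacobian x) := by
    rw [tangentBundleCore_coordChange]
    simp only [coe_achart, OpenPartialHomeomorph.extend, chartAt_ptU, chartAt_ptV (y := 0) rfl,
      mfld_simps, fderivWithin_univ]
    exact (hasFDerivAt_tau hx).fderiv
  have hVU : (tangentBundleCore 𝓘(ℂ, C3) W2).coordChange (achart C3 (ptV 0)) (achart C3 (ptU x))
      (ptU x) = matrixCLM (jacobian (tau x)) := by
    rw [tangentBundleCore_coordChange]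
    simp only [coe_achart, OpenPartialHomeomorph.extend, chartAt_ptU, chartAt_ptV (y := 0) rfl,
      mfld_simps, fderivWithin_univ]
    exact (hasFDerivAt_tau (x := tau x) (inv_ne_zero hx)).fderiv
  unfold endCoord ContinuousLinearMap.inCoordinates
  rw [TangentBundle.continuousLinearMapAt_trivializationAt_eq_core hp,
    TangentBundle.symmL_trivializationAt_eq_core hp, hUV, hVU]
  rfl

/-- The matrix at the point `ptU x` of a section of `End(TW₂)`, in the frame
`∂/∂z, ∂/∂u₁, ∂/∂u₂` of the chart `U`; zero outside the domain of the section. -/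
def matrixU {O : TopologicalSpace.Opens W2} (x : C3) :
    (∀ p : O, EndT p) →ₗ[ℂ] Matrix (Fin 3) (Fin 3) ℂ where
  toFun s := matrixCLM.symm (extend s (ptU x))
  map_add' s t := by
    have h : extend (s + t) (ptU x) = extend s (ptU x) + extend t (ptU x) := by
      by_cases hp : ptU x ∈ O <;> simp [extend, hp]
    exact (congrArg matrixCLM.symm h).trans (map_add matrixCLM.symm _ _)
  map_smul' c s := by
    have h : extend (c • s) (ptU x) = c • extend s (ptU x) := by
      by_cases hp : ptU x ∈ O <;> simp [extend, hp]
    exact (congrArg matrixCLM.symm h).trans (map_smul matrixCLM.symm _ _)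

/-- The matrix at the point `ptV y` of a section of `End(TW₂)`, in the frame
`∂/∂ξ, ∂/∂v₁, ∂/∂v₂` of the chart `V`; zero outside the domain of the section. -/
def matrixV {O : TopologicalSpace.Opens W2} (y : C3) (s : ∀ p : O, EndT p) :
    Matrix (Fin 3) (Fin 3) ℂ :=
  matrixCLM.symm (endCoord (ptV 0) (ptV y) (extend s (ptV y)))

variable {O : TopologicalSpace.Opens W2}

lemma extend_of_mem (s : ∀ p : O, EndT p) {p : W2} (hp : p ∈ O) : extend s p = s ⟨p, hp⟩ :=
  dif_pos hp

lemma isHolSection_iff_matrixU (hO : O ≤ U) (s : ∀ p : O, EndT p) :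
    IsHolSection O s ↔
      ∀ i j, DifferentiableOn ℂ (fun x => matrixU x s i j) (ptU ⁻¹' O) := by
  have hO' : (O : Set W2) ⊆ (chartAt C3 (ptU 0)).source := by rwa [chartAt_ptU_source]
  rw [isHolSection_iff_endCoord _ hO', mdifferentiableOn_iff_ptU hO,
    differentiableOn_iff_matrixCLM_symm]
  simp only [endCoord_ptU (ptU_mem_U _)]
  rfl

lemma isHolSection_iff_matrixV (hO : O ≤ V) (s : ∀ p : O, EndT p) :
    IsHolSection O s ↔
      ∀ i j, DifferentiableOn ℂ (fun y => matrixV y s i j) (ptV ⁻¹' O) := by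
  have hO' : (O : Set W2) ⊆ (chartAt C3 (ptV 0)).source := by rwa [chartAt_ptV_source rfl]
  rw [isHolSection_iff_endCoord _ hO', mdifferentiableOn_iff_ptV hO,
    differentiableOn_iff_matrixCLM_symm]
  rfl

lemma matrixU_eq_mul_matrixV_mul (s : ∀ p : O, EndT p) {x : C3} (hx : x 0 ≠ 0) :
    matrixU x s = jacobian (tau x) * matrixV (tau x) s * jacobian x := by
  have hV : matrixV (tau x) s = jacobian x * matrixU x s * jacobian (tau x) := by
    rw [matrixV, ← ptU_eq_ptV hx, endCoord_ptV hx, AlgEquiv.symm_apply_eq, map_mul, map_mul,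
      mul_assoc]
    congr 2
    exact (matrixCLM.apply_symm_apply _).symm
  have hJ := jacobian_tau_mul_jacobian hx
  rw [hV, ← mul_assoc, ← mul_assoc, hJ, one_mul, mul_assoc, hJ, mul_one]

lemma ofMatrixU_eq {p : W2} (hp : p ∈ U) (M : Matrix (Fin 3) (Fin 3) ℂ) :
    ofMatrixU p M = matrixCLM M := by
  obtain ⟨x, rfl⟩ := hp
  have hcoordU : (mfderiv 𝓘(ℂ, C3) 𝓘(ℂ, C3) coordU (ptU x) : C3 →L[ℂ] C3) = .id ℂ C3 := by
    refine (mdifferentiableAt_coordU (ptU_mem_U x)).mfderiv.trans ?_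
    simp only [writtenInExtChartAt, extChartAt, chartAt_ptU, mfld_simps, fderivWithin_univ]
    exact fderiv_id
  have hptU : (mfderiv 𝓘(ℂ, C3) 𝓘(ℂ, C3) ptU x : C3 →L[ℂ] C3) = .id ℂ C3 := by
    refine (mdifferentiable_ptU x).mfderiv.trans ?_
    simp only [writtenInExtChartAt, extChartAt, chartAt_ptU, mfld_simps, fderivWithin_univ]
    exact fderiv_id
  unfold ofMatrixU
  rw [hcoordU, coordU_ptU, hptU]
  rfl

/-- The map `ofMatrixU p`, as a linear map. -/
def ofMatrixULinear (p : W2) : Matrix (Fin 3) (Fin 3) ℂ →ₗ[ℂ] EndT p :=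
  LinearMap.mulLeft ℂ (mfderiv 𝓘(ℂ, C3) 𝓘(ℂ, C3) ptU (coordU p) : C3 →L[ℂ] C3) ∘ₗ
    LinearMap.mulRight ℂ (mfderiv 𝓘(ℂ, C3) 𝓘(ℂ, C3) coordU p : C3 →L[ℂ] C3) ∘ₗ
      matrixCLM.toLinearMap

lemma matrixU_ofMatrixU (M : C3 → Matrix (Fin 3) (Fin 3) ℂ) {x : C3} (hO : O ≤ U)
    (hx : ptU x ∈ O) : matrixU (O := O) x (fun p => ofMatrixU p (M (coordU p))) = M x := by
  change matrixCLM.symm (extend _ (ptU x)) = _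
  rw [extend_of_mem _ hx, ofMatrixU_eq (hO hx), coordU_ptU]
  exact matrixCLM.symm_apply_apply _

lemma isHolSection_ofMatrixU {M : C3 → Matrix (Fin 3) (Fin 3) ℂ} (hO : O ≤ U)
    (hM : ∀ i j, DifferentiableOn ℂ (fun x => M x i j) (ptU ⁻¹' O)) :
    IsHolSection O fun p => ofMatrixU p (M (coordU p)) :=
  (isHolSection_iff_matrixU hO _).2 fun i j => (hM i j).congr fun x hx => by
    rw [matrixU_ofMatrixU M hO hx]

lemma exists_matrixV_eq {B : C3 → Matrix (Fin 3) (Fin 3) ℂ}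
    (hB : ∀ i j, Differentiable ℂ fun y => B y i j) :
    ∃ b : sections V, ∀ y, matrixV y b.1 = B y := by
  have hsurj (p : V) : ∃ φ : EndT p, endCoord (ptV 0) p φ = matrixCLM (B (coordV p)) := by
    let e := trivializationAt C3 T (ptV 0)
    have hp : (p : W2) ∈ e.baseSet := by
      rw [TangentBundle.trivializationAt_baseSet, chartAt_ptV_source rfl]
      exact p.2
    refine ⟨e.symmL ℂ p ∘L matrixCLM (B (coordV p)) ∘L e.continuousLinearMapAt ℂ p, ?_⟩
    ext1 v
    exact (e.continuousLinearMapAt_symmL hp _).trans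
      (congrArg (matrixCLM (B (coordV p))) (e.continuousLinearMapAt_symmL hp v))
  choose b hb using hsurj
  have hbB (y : C3) : matrixV y b = B y := by
    rw [matrixV, extend_of_mem _ (ptV_mem_V y), AlgEquiv.symm_apply_eq]
    exact hb ⟨ptV y, ptV_mem_V y⟩
  refine ⟨⟨b, (isHolSection_iff_matrixV le_rfl b).2 fun i j => ?_⟩, hbB⟩
  simpa only [hbB] using (hB i j).differentiableOn

lemma matrixU_cechD (a : sections U) (b : sections V) {x : C3} (hx : x 0 ≠ 0) :
    matrixU x (cechD (a, b)).1 = matrixU x b.1 - matrixU x a.1 := by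
  have hp := ptU_mem_inf.2 hx
  change matrixCLM.symm (extend _ (ptU x)) =
    matrixCLM.symm (extend _ (ptU x)) - matrixCLM.symm (extend _ (ptU x))
  rw [extend_of_mem _ hp, extend_of_mem _ hp.1, extend_of_mem _ hp.2]
  exact map_sub _ _ _

lemma sections_ext_matrixU {σ σ' : sections (U ⊓ V)}
    (h : ∀ x : C3, x 0 ≠ 0 → matrixU x σ.1 = matrixU x σ'.1) : σ = σ' := by
  ext1
  funext ⟨p, hp⟩
  obtain ⟨x, rfl⟩ := hp.1
  have hx := matrixCLM.symm.injective (h x (ptU_mem_inf.1 hp))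
  rwa [extend_of_mem _ hp, extend_of_mem _ hp] at hx

end Frames

section NormalForm

/-- `M` is the matrix function over `U ∩ V`, in the frame of `U`, of a Čech coboundary: it is the
sum of an entire matrix function on `U` and of one on `V`, the latter written in the frame of
`U`. -/
def IsCoboundary (M : C3 → Matrix (Fin 3) (Fin 3) ℂ) : Prop :=
  ∃ A B : C3 → Matrix (Fin 3) (Fin 3) ℂ,
    (∀ i j, Differentiable ℂ fun x => A x i j) ∧ (∀ i j, Differentiable ℂ fun y => B y i j) ∧
      ∀ x : C3, x 0 ≠ 0 → M x = A x + jacobian (tau x) * B (tau x) * jacobian x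

theorem mem_range_cechD_iff_isCoboundary {σ : sections (U ⊓ V)} :
    σ ∈ LinearMap.range cechD ↔ IsCoboundary fun x => matrixU x σ.1 := by
  constructor
  · rintro ⟨⟨a, b⟩, rfl⟩
    have ha := (isHolSection_iff_matrixU le_rfl a.1).1 a.2
    have hb := (isHolSection_iff_matrixV le_rfl b.1).1 b.2
    simp only [preimage_ptU_U, preimage_ptV_V, differentiableOn_univ] at ha hb
    refine ⟨fun x => -matrixU x a.1, fun y => matrixV y b.1, fun i j => (ha i j).neg, hb,
      fun x hx => ?_⟩
    beta_reduce
    rw [matrixU_cechD a b hx, ← matrixU_eq_mul_matrixV_mul _ hx]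
    abel
  · rintro ⟨A, B, hA, hB, hσ⟩
    have ha : IsHolSection U fun p => ofMatrixU p (-A (coordU p)) :=
      isHolSection_ofMatrixU (M := fun x => -A x) le_rfl fun i j => (hA i j).neg.differentiableOn
    obtain ⟨b, hb⟩ := exists_matrixV_eq hB
    refine ⟨(⟨_, ha⟩, b), sections_ext_matrixU fun x hx => ?_⟩
    have haA : matrixU x (fun p : U => ofMatrixU p (-A (coordU p))) = -A x :=
      matrixU_ofMatrixU (fun x => -A x) le_rfl (ptU_mem_U x)
    refine (matrixU_cechD _ b hx).trans (Eq.trans ?_ (hσ x hx).symm)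
    rw [matrixU_eq_mul_matrixV_mul b.1 hx, hb]
    refine (congrArg _ haA).trans ?_
    abel

lemma isCoboundary_zero : IsCoboundary 0 :=
  ⟨0, 0, fun _ _ => differentiable_zero, fun _ _ => differentiable_zero, by simp⟩

lemma IsCoboundary.add {M N : C3 → Matrix (Fin 3) (Fin 3) ℂ} (hM : IsCoboundary M)
    (hN : IsCoboundary N) : IsCoboundary fun x => M x + N x := by
  obtain ⟨A, B, hA, hB, hM⟩ := hM
  obtain ⟨A', B', hA', hB', hN⟩ := hN
  refine ⟨fun x => A x + A' x, fun y => B y + B' y, fun i j => (hA i j).add (hA' i j),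
    fun i j => (hB i j).add (hB' i j), fun x hx => ?_⟩
  beta_reduce
  rw [hM x hx, hN x hx, mul_add, add_mul]
  abel

/-- `M` is the matrix function of a cocycle that is a coboundary plus a combination of the
generators `genMatrix m 0`, with coefficients that are entire functions of `u₂`. -/
def HasNormalForm (M : C3 → Matrix (Fin 3) (Fin 3) ℂ) : Prop :=
  ∃ h : Fin 6 → ℂ → ℂ, (∀ m, Differentiable ℂ (h m)) ∧
    IsCoboundary fun x => M x - ∑ m, h m (x 2) • genMatrix m 0 x

lemma IsCoboundary.hasNormalForm {M : C3 → Matrix (Fin 3) (Fin 3) ℂ} (hM : IsCoboundary M) :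
    HasNormalForm M :=
  ⟨fun _ _ => 0, by fun_prop, by simpa⟩

lemma HasNormalForm.congr {M N : C3 → Matrix (Fin 3) (Fin 3) ℂ} (hM : HasNormalForm M)
    (hMN : ∀ x : C3, x 0 ≠ 0 → N x = M x) : HasNormalForm N := by
  obtain ⟨h, hh, A, B, hA, hB, hM⟩ := hM
  exact ⟨h, hh, A, B, hA, hB, fun x hx => (congrArg (· - _) (hMN x hx)).trans (hM x hx)⟩

lemma HasNormalForm.add {M N : C3 → Matrix (Fin 3) (Fin 3) ℂ} (hM : HasNormalForm M)
    (hN : HasNormalForm N) : HasNormalForm fun x => M x + N x := by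
  obtain ⟨h, hh, hM⟩ := hM
  obtain ⟨h', hh', hN⟩ := hN
  refine ⟨fun m t => h m t + h' m t, fun m => (hh m).add (hh' m), ?_⟩
  simpa only [add_smul, Finset.sum_add_distrib, add_sub_add_comm] using hM.add hN

lemma differentiable_single_apply {f : C3 → ℂ} (hf : Differentiable ℂ f) (i j i' j' : Fin 3) :
    Differentiable ℂ fun x => Matrix.single i j (f x) i' j' := by
  by_cases h : i = i' ∧ j = j'
  · simpa [Matrix.single_apply, h] using hf
  · simp [h]

lemma differentiableOn_inv_coord : DifferentiableOn ℂ (fun x : C3 => (x 0)⁻¹) {x | x 0 ≠ 0} :=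
  DifferentiableOn.inv (by fun_prop) fun _ hx => hx

lemma differentiableOn_comp_tau {G : C3 → ℂ} (hG : Differentiable ℂ G) :
    DifferentiableOn ℂ (fun x => G (tau x)) {x | x 0 ≠ 0} :=
  hG.comp_differentiableOn fun _ hx => (hasFDerivAt_tau hx).differentiableAt.differentiableWithinAt

lemma jacobian_mul_single_mul_jacobian_apply (x y : C3) (i j k l : Fin 3) (b : ℂ) :
    (jacobian y * Matrix.single i j b * jacobian x) k l =
      jacobian y k i * b * jacobian x j l := by
  simp [Matrix.mul_apply, Matrix.single_apply, ite_and]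

variable {f : C3 → ℂ}

lemma hasNormalForm_single_one_zero (hf : DifferentiableOn ℂ f {x | x 0 ≠ 0}) :
    HasNormalForm fun x => Matrix.single 1 0 (f x) := by
  obtain ⟨P, G, c, hP, hG, hc, hf⟩ := exists_decomposition_comp_tau 4 hf
  refine ⟨![c 3 1, c 1 0, c 2 0, c 3 0, 0, 0], ?_, fun x => Matrix.single 1 0 (P x),
    fun y => Matrix.single 1 0 (-G y), differentiable_single_apply hP 1 0,
    differentiable_single_apply hG.neg 1 0, fun x hx => ?_⟩
  · simp [Fin.forall_fin_succ, hc, differentiable_zero]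
  · beta_reduce
    ext i j
    rw [Matrix.add_apply, jacobian_mul_single_mul_jacobian_apply, hf x hx]
    fin_cases i <;> fin_cases j <;>
      simp [Fin.sum_univ_six, genMatrix, jacobian, Finset.sum_range_succ]
    field_simp
    ring

lemma hasNormalForm_single_one_two (hf : DifferentiableOn ℂ f {x | x 0 ≠ 0}) :
    HasNormalForm fun x => Matrix.single 1 2 (f x) := by
  obtain ⟨P, G, c, hP, hG, hc, hf⟩ := exists_decomposition_comp_tau 2 hf
  refine ⟨![0, 0, 0, 0, c 1 0, 0], ?_, fun x => Matrix.single 1 2 (P x),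
    fun y => Matrix.single 1 2 (G y), differentiable_single_apply hP 1 2,
    differentiable_single_apply hG 1 2, fun x hx => ?_⟩
  · simp [Fin.forall_fin_succ, hc, differentiable_zero]
  · beta_reduce
    ext i j
    rw [Matrix.add_apply, jacobian_mul_single_mul_jacobian_apply, hf x hx]
    fin_cases i <;> fin_cases j <;>
      simp [Fin.sum_univ_six, genMatrix, jacobian, Finset.sum_range_succ]
    ring

lemma hasNormalForm_single_two_zero (hf : DifferentiableOn ℂ f {x | x 0 ≠ 0}) :
    HasNormalForm fun x => Matrix.single 2 0 (f x) := by
  obtain ⟨P, G, c, hP, hG, hc, hf⟩ := exists_decomposition_comp_tau 2 hf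
  refine ⟨![0, 0, 0, 0, 0, c 1 0], ?_, fun x => Matrix.single 2 0 (P x),
    fun y => Matrix.single 2 0 (-G y), differentiable_single_apply hP 2 0,
    differentiable_single_apply hG.neg 2 0, fun x hx => ?_⟩
  · simp [Fin.forall_fin_succ, hc, differentiable_zero]
  · beta_reduce
    ext i j
    rw [Matrix.add_apply, jacobian_mul_single_mul_jacobian_apply, hf x hx]
    fin_cases i <;> fin_cases j <;>
      simp [Fin.sum_univ_six, genMatrix, jacobian, Finset.sum_range_succ]
    ring

lemma hasNormalForm_single_of_conj {i j : Fin 3} {b : C3 → ℂ} (hb : Differentiable ℂ b)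
    {R : C3 → Matrix (Fin 3) (Fin 3) ℂ}
    (hconj : ∀ x : C3, x 0 ≠ 0 → Matrix.single i j 1 =
      jacobian (tau x) * Matrix.single i j (b (tau x)) * jacobian x + R x)
    (hR : ∀ g : C3 → ℂ, DifferentiableOn ℂ g {x | x 0 ≠ 0} → HasNormalForm fun x => g x • R x)
    (hf : DifferentiableOn ℂ f {x | x 0 ≠ 0}) :
    HasNormalForm fun x => Matrix.single i j (f x) := by
  obtain ⟨P, G, c, hP, hG, -, hf⟩ := exists_decomposition_comp_tau 0 hf
  -- Moved to the frame of `U`, `b E_ij` is `E_ij` up to `R`, so the `V`-part `G (tau x) E_ij` is a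
  -- coboundary up to `G (tau x) R`.
  have hcob : IsCoboundary fun x => Matrix.single i j (P x) +
      jacobian (tau x) * Matrix.single i j (G (tau x) * b (tau x)) * jacobian x :=
    ⟨fun x => Matrix.single i j (P x), fun y => Matrix.single i j (G y * b y),
      differentiable_single_apply hP i j, differentiable_single_apply (hG.mul hb) i j,
      fun _ _ => rfl⟩
  refine (hcob.hasNormalForm.add (hR _ (differentiableOn_comp_tau hG))).congr fun x hx => ?_
  have hG_single : Matrix.single i j (G (tau x)) = G (tau x) • Matrix.single i j 1 := by simp
  have hGb_single : Matrix.single i j (G (tau x) * b (tau x)) =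
      G (tau x) • Matrix.single i j (b (tau x)) := by simp
  rw [hf x hx, Finset.range_zero, Finset.sum_empty, add_zero, pow_zero, inv_one, one_mul,
    Matrix.single_add, hG_single, hconj x hx, hGb_single, smul_add, Matrix.mul_smul,
    Matrix.smul_mul, add_assoc]

lemma hasNormalForm_single_two_two (hf : DifferentiableOn ℂ f {x | x 0 ≠ 0}) :
    HasNormalForm fun x => Matrix.single 2 2 (f x) := by
  refine hasNormalForm_single_of_conj (b := 1) differentiable_one (R := 0) (fun x _ => ?_)
    (fun g _ => ?_) hf
  · ext i j
    rw [Matrix.add_apply, jacobian_mul_single_mul_jacobian_apply]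
    fin_cases i <;> fin_cases j <;> simp [jacobian]
  · simpa using! isCoboundary_zero.hasNormalForm

lemma hasNormalForm_single_two_one (hf : DifferentiableOn ℂ f {x | x 0 ≠ 0}) :
    HasNormalForm fun x => Matrix.single 2 1 (f x) := by
  refine hasNormalForm_single_of_conj (b := fun y => y 0 ^ 2) (by fun_prop)
    (R := fun x => Matrix.single 2 0 (-2 * (x 0)⁻¹ * x 1)) (fun x hx => ?_) (fun g hg => ?_) hf
  · ext i j
    rw [Matrix.add_apply, jacobian_mul_single_mul_jacobian_apply]
    fin_cases i <;> fin_cases j <;> simp [jacobian]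
    all_goals field_simp
    ring
  · simp only [Matrix.smul_single]
    exact hasNormalForm_single_two_zero (by fun_prop (disch := simp))

lemma hasNormalForm_single_zero_zero (hf : DifferentiableOn ℂ f {x | x 0 ≠ 0}) :
    HasNormalForm fun x => Matrix.single 0 0 (f x) := by
  refine hasNormalForm_single_of_conj (b := 1) differentiable_one
    (R := fun x => Matrix.single 1 0 (2 * (x 0)⁻¹ * x 1)) (fun x hx => ?_) (fun g hg => ?_) hf
  · ext i j
    rw [Matrix.add_apply, jacobian_mul_single_mul_jacobian_apply]
    fin_cases i <;> fin_cases j <;> simp [jacobian]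
    all_goals field_simp
    ring
  · simp only [Matrix.smul_single]
    exact hasNormalForm_single_one_zero (by fun_prop (disch := simp))

lemma hasNormalForm_single_one_one (hf : DifferentiableOn ℂ f {x | x 0 ≠ 0}) :
    HasNormalForm fun x => Matrix.single 1 1 (f x) := by
  refine hasNormalForm_single_of_conj (b := 1) differentiable_one
    (R := fun x => Matrix.single 1 0 (-2 * (x 0)⁻¹ * x 1)) (fun x hx => ?_) (fun g hg => ?_) hf
  · ext i j
    rw [Matrix.add_apply, jacobian_mul_single_mul_jacobian_apply]
    fin_cases i <;> fin_cases j <;> simp [jacobian]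
    all_goals field_simp
    ring
  · simp only [Matrix.smul_single]
    exact hasNormalForm_single_one_zero (by fun_prop (disch := simp))

lemma hasNormalForm_single_zero_two (hf : DifferentiableOn ℂ f {x | x 0 ≠ 0}) :
    HasNormalForm fun x => Matrix.single 0 2 (f x) := by
  refine hasNormalForm_single_of_conj (b := fun y => -y 0 ^ 2) (by fun_prop)
    (R := fun x => Matrix.single 1 2 (2 * (x 0)⁻¹ * x 1)) (fun x hx => ?_) (fun g hg => ?_) hf
  · ext i j
    rw [Matrix.add_apply, jacobian_mul_single_mul_jacobian_apply]
    fin_cases i <;> fin_cases j <;> simp [jacobian]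
    all_goals field_simp
    ring
  · simp only [Matrix.smul_single]
    exact hasNormalForm_single_one_two (by fun_prop (disch := simp))

lemma hasNormalForm_single_zero_one (hf : DifferentiableOn ℂ f {x | x 0 ≠ 0}) :
    HasNormalForm fun x => Matrix.single 0 1 (f x) := by
  refine hasNormalForm_single_of_conj (b := fun y => -y 0 ^ 4) (by fun_prop)
    (R := fun x => Matrix.single 0 0 (-2 * (x 0)⁻¹ * x 1) +
      Matrix.single 1 1 (2 * (x 0)⁻¹ * x 1) +
      Matrix.single 1 0 (4 * (x 0 ^ 2)⁻¹ * x 1 ^ 2)) (fun x hx => ?_) (fun g hg => ?_) hf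
  · ext i j
    rw [Matrix.add_apply, jacobian_mul_single_mul_jacobian_apply]
    fin_cases i <;> fin_cases j <;> simp [jacobian] <;> field_simp <;> ring
  · simp only [smul_add, Matrix.smul_single]
    exact ((hasNormalForm_single_zero_zero (by fun_prop (disch := simp))).add
      (hasNormalForm_single_one_one (by fun_prop (disch := simp)))).add
      (hasNormalForm_single_one_zero (by fun_prop (disch := simp)))

lemma hasNormalForm_single (i j : Fin 3) (hf : DifferentiableOn ℂ f {x | x 0 ≠ 0}) :
    HasNormalForm fun x => Matrix.single i j (f x) := by
  fin_cases i <;> fin_cases j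
  exacts [hasNormalForm_single_zero_zero hf, hasNormalForm_single_zero_one hf,
    hasNormalForm_single_zero_two hf, hasNormalForm_single_one_zero hf,
    hasNormalForm_single_one_one hf, hasNormalForm_single_one_two hf,
    hasNormalForm_single_two_zero hf, hasNormalForm_single_two_one hf,
    hasNormalForm_single_two_two hf]

lemma HasNormalForm.sum {ι : Type*} (s : Finset ι) {M : ι → C3 → Matrix (Fin 3) (Fin 3) ℂ}
    (hM : ∀ i ∈ s, HasNormalForm (M i)) : HasNormalForm (∑ i ∈ s, M i) :=
  Finset.sum_induction M HasNormalForm (fun _ _ h h' => h.add h') isCoboundary_zero.hasNormalForm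
    hM

lemma hasNormalForm_of_differentiableOn {M : C3 → Matrix (Fin 3) (Fin 3) ℂ}
    (hM : ∀ i j, DifferentiableOn ℂ (fun x => M x i j) {x | x 0 ≠ 0}) : HasNormalForm M := by
  have h_sum : HasNormalForm (∑ i, ∑ j, fun x => Matrix.single i j (M x i j)) :=
    .sum _ fun i _ => .sum _ fun j _ => hasNormalForm_single i j (hM i j)
  refine h_sum.congr fun x _ => ?_
  simpa only [Finset.sum_apply] using Matrix.matrix_eq_sum_single (M x)

end NormalForm

section Moduli

/-- The infinitesimal automorphism `1 + εa` defined by a holomorphic section `a`. -/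
def InfAut.ofSection {O : TopologicalSpace.Opens W2} (a : sections O) : InfAut O where
  val p := TrivSqZeroExt.inl 1 + TrivSqZeroExt.inr (a.1 p)
  fst_eq p := by simp
  snd_hol := by
    have ha : IsHolSection O a.1 := a.2
    simpa using ha

@[simp] lemma InfAut.snd_ofSection {O : TopologicalSpace.Opens W2} (a : sections O) (p : O) :
    ((InfAut.ofSection a).val p).snd = a.1 p := by
  simp [InfAut.ofSection]

lemma dualNumber_mul_eq_mul_iff {R : Type*} [Ring R] {a b c d : DualNumber R}
    (ha : a.fst = 1) (hb : b.fst = 1) (hc : c.fst = 1) (hd : d.fst = 1) :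
    a * b = c * d ↔ a.snd - d.snd = c.snd - b.snd := by
  rw [TrivSqZeroExt.ext_iff, sub_eq_sub_iff_add_eq_add, add_comm a.snd, add_comm c.snd]
  simp [ha, hb, hc, hd]

lemma FirstOrderDeformation.iso_iff_cls_eq {g g' : FirstOrderDeformation} :
    g.Iso g' ↔ cls g.cocycle = cls g'.cocycle := by
  have hcls : cls g.cocycle = cls g'.cocycle ↔
      g'.cocycle - g.cocycle ∈ LinearMap.range cechD :=
    eq_comm.trans (Submodule.Quotient.eq _)
  rw [hcls]
  constructor
  · rintro ⟨a, b, hab⟩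
    refine ⟨(⟨fun p => (a.val p).snd, a.snd_hol⟩, ⟨fun p => (b.val p).snd, b.snd_hol⟩),
      Subtype.ext (funext fun p => ?_)⟩
    exact (dualNumber_mul_eq_mul_iff (b.fst_eq _) (g.fst_eq _) (g'.fst_eq _) (a.fst_eq _)).1 (hab p)
  · rintro ⟨⟨a, b⟩, hab⟩
    refine ⟨.ofSection a, .ofSection b, fun p => ?_⟩
    refine (dualNumber_mul_eq_mul_iff ((InfAut.ofSection b).fst_eq _) (g.fst_eq _)
      (g'.fst_eq _) ((InfAut.ofSection a).fst_eq _)).2 ?_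
    rw [InfAut.snd_ofSection, InfAut.snd_ofSection]
    exact congrFun (congrArg Subtype.val hab) p

/-- The bijection from the tangent space of the moduli to `H¹(W₂, End(TW₂))` that sends the
deformation glued by `1 + εσ` to the class of `σ`. -/
def moduliTangentSpaceEquiv : ModuliTangentSpace ≃ H1 := by
  refine Equiv.ofBijective (Quot.lift (fun g : FirstOrderDeformation => cls g.cocycle)
    fun _ _ => FirstOrderDeformation.iso_iff_cls_eq.1) ⟨?_, fun ξ => ?_⟩
  · rintro ⟨g⟩ ⟨g'⟩ h
    exact Quot.sound (FirstOrderDeformation.iso_iff_cls_eq.2 h)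
  · obtain ⟨σ, rfl⟩ := Submodule.mkQ_surjective _ ξ
    exact ⟨Quot.mk _ (.ofSection σ),
      congrArg cls (Subtype.ext (funext (InfAut.snd_ofSection σ)))⟩

end Moduli

section Family

lemma mdifferentiableOn_family_iff {E : Type*} [NormedAddCommGroup E] [NormedSpace ℂ E]
    {O : TopologicalSpace.Opens W2} (hO : O ≤ U) {θ : E → ∀ p : W2, EndT p} :
    MDifferentiableOn (𝓘(ℂ, E).prod 𝓘(ℂ, C3)) (𝓘(ℂ, C3).prod 𝓘(ℂ, C3 →L[ℂ] C3))
        (fun x : E × W2 => TotalSpace.mk' (C3 →L[ℂ] C3) (E := EndT) x.2 (θ x.1 x.2))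
        (Set.univ ×ˢ (O : Set W2)) ↔
      MDifferentiableOn (𝓘(ℂ, E).prod 𝓘(ℂ, C3)) 𝓘(ℂ, C3 →L[ℂ] C3)
        (fun x => endCoord (ptU 0) x.2 (θ x.1 x.2)) (Set.univ ×ˢ (O : Set W2)) := by
  refine forall₂_congr fun x hx => ?_
  have hx' : x.2 ∈ (chartAt C3 (ptU 0)).source := by
    rw [chartAt_ptU_source]
    exact hO hx.2
  have hbase : x.2 ∈ (trivializationAt (C3 →L[ℂ] C3) EndT (ptU 0)).baseSet := ⟨hx', hx'⟩
  exact ((trivializationAt (C3 →L[ℂ] C3) EndT (ptU 0)).mdifferentiableWithinAt_totalSpace_iff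
    𝓘(ℂ, C3) (fun x : E × W2 => TotalSpace.mk' _ x.2 (θ x.1 x.2)) hbase).trans
    (and_iff_right mdifferentiableWithinAt_snd)

lemma mdifferentiableOn_one_add_linear {n : ℕ} {O : TopologicalSpace.Opens W2} (hO : O ≤ U)
    (κ : (Fin n → ℂ) →ₗ[ℂ] sections O) :
    MDifferentiableOn (𝓘(ℂ, Fin n → ℂ).prod 𝓘(ℂ, C3)) (𝓘(ℂ, C3).prod 𝓘(ℂ, C3 →L[ℂ] C3))
      (fun x : (Fin n → ℂ) × W2 => TotalSpace.mk' (C3 →L[ℂ] C3) (E := EndT) x.2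
        (extend (fun p : O => 1 + (κ x.1).1 p) x.2)) (Set.univ ×ˢ (O : Set W2)) := by
  have hsource : (O : Set W2) ⊆ (chartAt C3 (ptU 0)).source := by rwa [chartAt_ptU_source]
  let σ (k : Fin n) (p : W2) : C3 →L[ℂ] C3 :=
    endCoord (ptU 0) p (extend (κ (Pi.single k 1)).1 p)
  have hσ (k : Fin n) : MDifferentiableOn 𝓘(ℂ, C3) 𝓘(ℂ, C3 →L[ℂ] C3) (σ k) O :=
    (isHolSection_iff_endCoord _ hsource _).1 (κ (Pi.single k 1)).2
  have hsum : MDifferentiableOn (𝓘(ℂ, Fin n → ℂ).prod 𝓘(ℂ, C3)) 𝓘(ℂ, C3 →L[ℂ] C3)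
      (fun x : (Fin n → ℂ) × W2 => 1 + ∑ k, x.1 k • σ k x.2) (Set.univ ×ˢ (O : Set W2)) := by
    have hcoord (k : Fin n) : MDifferentiableOn (𝓘(ℂ, Fin n → ℂ).prod 𝓘(ℂ, C3)) 𝓘(ℂ, ℂ)
        (fun x : (Fin n → ℂ) × W2 => x.1 k) (Set.univ ×ˢ (O : Set W2)) :=
      MDifferentiable.comp_mdifferentiableOn (I' := 𝓘(ℂ, Fin n → ℂ)) (g := fun t => t k)
        (differentiable_apply k).mdifferentiable mdifferentiableOn_fst
    have hterm (k : Fin n) : MDifferentiableOn (𝓘(ℂ, Fin n → ℂ).prod 𝓘(ℂ, C3))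
        𝓘(ℂ, C3 →L[ℂ] C3) (fun x : (Fin n → ℂ) × W2 => x.1 k • σ k x.2)
        (Set.univ ×ˢ (O : Set W2)) :=
      (hcoord k).fun_smul ((hσ k).comp mdifferentiableOn_snd fun _ hx => hx.2)
    refine (mdifferentiableOn_const (c := (1 : C3 →L[ℂ] C3)).add
      (MDifferentiableOn.sum (t := Finset.univ) fun k _ => hterm k)).congr fun x _ => ?_
    simp only [Pi.add_apply, Finset.sum_apply]
  refine (mdifferentiableOn_family_iff hO
    (θ := fun t => extend fun p : O => 1 + (κ t).1 p)).2 (hsum.congr ?_)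
  rintro ⟨t, p⟩ ⟨-, hp⟩
  have hκ : (κ t).1 ⟨p, hp⟩ = ∑ k, t k • (κ (Pi.single k 1)).1 ⟨p, hp⟩ := by
    conv_lhs => rw [pi_eq_sum_univ' t]
    simp
  simp only [σ, endCoord_ptU (hO hp), extend_of_mem _ hp]
  exact congrArg (1 + ·) hκ

variable {n : ℕ}

/-- The family of bundles glued by `1 + κ t`, where `κ t` is a nilpotent endomorphism of
`TW₂|_{U ∩ V}` that depends linearly on `t`. -/
def Family.ofNilpotent (κ : (Fin n → ℂ) →ₗ[ℂ] sections (U ⊓ V))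
    (hκ : ∀ t p, IsNilpotent ((κ t).1 p)) : Family n where
  θ t p := 1 + (κ t).1 p
  hol := mdifferentiableOn_one_add_linear inf_le_left κ
  isUnit t p := (hκ t p).isUnit_one_add
  zero p := by simp

lemma Family.isKodairaSpencer_ofNilpotent (κ : (Fin n → ℂ) →ₗ[ℂ] sections (U ⊓ V))
    (hκ : ∀ t p, IsNilpotent ((κ t).1 p)) : (Family.ofNilpotent κ hκ).IsKodairaSpencer κ := by
  intro v p
  let φ : C3 →L[ℂ] C3 := (κ v).1 p
  have hθ (s : ℂ) : (Family.ofNilpotent κ hκ).θ (s • v) p = (1 : C3 →L[ℂ] C3) + s • φ :=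
    congrArg (1 + ·) (congrFun (congrArg Subtype.val (map_smul κ s v)) p)
  have hderiv : HasDerivAt (fun s : ℂ => (1 : C3 →L[ℂ] C3) + s • φ) φ 0 := by
    simpa using ((hasDerivAt_id (0 : ℂ)).smul_const φ).const_add 1
  exact hderiv.congr_of_eventuallyEq (.of_forall hθ)

end Family

section PolynomialCocycles

open Polynomial

lemma IsCoboundary.eq_zero_of_single_one_two {h : ℂ → ℂ}
    (hM : IsCoboundary fun x => Matrix.single 1 2 ((x 0)⁻¹ * h (x 2))) (t : ℂ) : h t = 0 := by
  obtain ⟨A, B, hA, hB, hAB⟩ := hM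
  have hentry (z : ℂ) (hz : z ≠ 0) :
      h t - z * A ![z, 0, t] 1 2 = z⁻¹ * B ![z⁻¹, 0, t] 1 2 := by
    have hx := congrFun (congrFun (hAB ![z, 0, t] hz) 1) 2
    have htau : tau ![z, 0, t] = ![z⁻¹, 0, t] := by simp [tau]
    simp only [htau, Matrix.add_apply, Matrix.mul_apply, Fin.sum_univ_three] at hx
    simp only [jacobian, inv_inv, inv_pow, Matrix.of_apply, Matrix.cons_val', Matrix.cons_val_zero,
      Matrix.cons_val_one, Matrix.cons_val, Matrix.cons_val_fin_one, Matrix.single_apply_same,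
      mul_zero, zero_mul, zero_add, add_zero, mul_one] at hx
    field_simp at hx ⊢
    linear_combination hx
  have hline : Differentiable ℂ fun z : ℂ => ![z, 0, t] := by fun_prop
  have hconst := apply_eq_of_eq_comp_inv (f := fun z => h t - z * A ![z, 0, t] 1 2)
    (g := fun ξ => ξ * B ![ξ, 0, t] 1 2)
    ((differentiable_const _).fun_sub (differentiable_id.mul ((hA 1 2).comp hline)))
    (differentiable_id.mul ((hB 1 2).comp hline)).continuous.continuousAt hentry 0
  simpa using hconst

/-- The matrix `z⁻¹ p(u₂) E₂₃` at `x = (z, u₁, u₂)`, as a linear function of `p`. -/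
def polynomialMatrix (x : C3) : ℂ[X] →ₗ[ℂ] Matrix (Fin 3) (Fin 3) ℂ :=
  Matrix.singleLinearMap ℂ 1 2 ∘ₗ ((x 0)⁻¹ • Polynomial.leval (x 2))

lemma polynomialMatrix_apply (x : C3) (p : ℂ[X]) :
    polynomialMatrix x p = Matrix.single 1 2 ((x 0)⁻¹ * p.eval (x 2)) := rfl

lemma isHolSection_polynomialMatrix (p : ℂ[X]) :
    IsHolSection (U ⊓ V) fun q => ofMatrixU q (polynomialMatrix (coordU q) p) := by
  refine isHolSection_ofMatrixU (M := fun x => polynomialMatrix x p) inf_le_left fun i j => ?_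
  have heval : Differentiable ℂ fun x : C3 => p.eval (x 2) :=
    p.differentiable.comp (differentiable_apply 2)
  simp only [preimage_ptU_inf, polynomialMatrix_apply, Matrix.single_apply]
  split_ifs
  · exact differentiableOn_inv_coord.mul heval.differentiableOn
  · exact differentiableOn_const 0

/-- The cocycle `z⁻¹ p(u₂) E₂₃` defined by a polynomial `p`. -/
def polynomialCocycle : ℂ[X] →ₗ[ℂ] sections (U ⊓ V) :=
  (LinearMap.pi fun q : (U ⊓ V : TopologicalSpace.Opens W2) =>
    ofMatrixULinear q ∘ₗ polynomialMatrix (coordU q.1)).codRestrict _ isHolSection_polynomialMatrix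

lemma matrixU_polynomialCocycle (p : ℂ[X]) {x : C3} (hx : x 0 ≠ 0) :
    matrixU x (polynomialCocycle p).1 = polynomialMatrix x p :=
  matrixU_ofMatrixU (fun x => polynomialMatrix x p) inf_le_left (ptU_mem_inf.2 hx)

lemma isNilpotent_polynomialCocycle (p : ℂ[X]) (q : (U ⊓ V : TopologicalSpace.Opens W2)) :
    IsNilpotent ((polynomialCocycle p).1 q) := by
  have hsq : IsNilpotent (polynomialMatrix (coordU q) p) :=
    ⟨2, by simp [sq, polynomialMatrix_apply]⟩
  have hmap := hsq.map matrixCLM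
  rwa [← ofMatrixU_eq q.2.1] at hmap

theorem injective_cls_polynomialCocycle : Function.Injective (cls ∘ₗ polynomialCocycle) := by
  rw [injective_iff_map_eq_zero]
  intro p hp
  obtain ⟨A, B, hA, hB, hAB⟩ := mem_range_cechD_iff_isCoboundary.1
    ((Submodule.Quotient.mk_eq_zero _).1 hp)
  have hcob : IsCoboundary fun x => polynomialMatrix x p :=
    ⟨A, B, hA, hB, fun x hx => (matrixU_polynomialCocycle p hx).symm.trans (hAB x hx)⟩
  refine Polynomial.funext fun t => ?_
  rw [Polynomial.eval_zero]
  exact hcob.eq_zero_of_single_one_two (h := fun t => p.eval t) t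

theorem not_finiteDimensional_H1 : ¬ FiniteDimensional ℂ H1 := fun _ =>
  have := Module.Finite.of_injective _ injective_cls_polynomialCocycle
  have := Module.Finite.finite_basis (Polynomial.basisMonomials ℂ)
  not_finite ℕ

/-- The cocycle `∑ₖ tₖ z⁻¹ u₂ᵏ E₂₃`, as a linear function of `t`. -/
def coefficientCocycle (n : ℕ) : (Fin n → ℂ) →ₗ[ℂ] sections (U ⊓ V) :=
  polynomialCocycle ∘ₗ (Polynomial.degreeLT ℂ n).subtype ∘ₗ
    (Polynomial.degreeLTEquiv ℂ n).symm.toLinearMap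

lemma injective_cls_coefficientCocycle (n : ℕ) :
    Function.Injective fun t => cls (coefficientCocycle n t) :=
  injective_cls_polynomialCocycle.comp <|
    Subtype.val_injective.comp (Polynomial.degreeLTEquiv ℂ n).symm.injective

end PolynomialCocycles

section Series

lemma differentiableOn_genMatrix (m : Fin 6) (k : ℕ) (i j : Fin 3) :
    DifferentiableOn ℂ (fun x => genMatrix m k x i j) {x | x 0 ≠ 0} := by
  have hinv := differentiableOn_inv_coord
  fin_cases m <;> simp only [genMatrix, Matrix.single_apply, ← inv_pow] <;> split_ifs <;> fun_prop

lemma gen_mem (i : Fin 6 × ℕ) : gen i ∈ sections (U ⊓ V) :=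
  isHolSection_ofMatrixU (M := genMatrix i.1 i.2) inf_le_left fun j k => by
    rw [preimage_ptU_inf]
    exact differentiableOn_genMatrix i.1 i.2 j k

lemma hasSum_prod_of_fintype {ι κ E : Type*} [Fintype ι] [AddCommMonoid E] [TopologicalSpace E]
    [ContinuousAdd E] {f : ι × κ → E} {g : ι → E} (hf : ∀ i, HasSum (fun k => f (i, k)) (g i)) :
    HasSum f (∑ i, g i) := by
  classical
  have hfiber (i : ι) : HasSum (fun p : ι × κ => if p.1 = i then f p else 0) (g i) := by
    rw [← (Prod.mk_right_injective i).hasSum_iff]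
    · simpa [Function.comp_def] using hf i
    · exact fun p hp => if_neg fun h => hp ⟨p.2, Prod.ext h.symm rfl⟩
  simpa using hasSum_sum (s := Finset.univ) fun i _ => hfiber i

lemma genMatrix_eq_smul (m : Fin 6) (k : ℕ) (x : C3) :
    genMatrix m k x = x 2 ^ k • genMatrix m 0 x := by
  fin_cases m <;> simp [genMatrix, mul_comm]

lemma hasSum_genMatrix {h : Fin 6 → ℂ → ℂ} (hh : ∀ m, Differentiable ℂ (h m)) (x : C3) :
    HasSum (fun i : Fin 6 × ℕ =>
        ((i.2.factorial : ℂ)⁻¹ * iteratedDeriv i.2 (h i.1) 0) • genMatrix i.1 i.2 x)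
      (∑ m, h m (x 2) • genMatrix m 0 x) := by
  refine hasSum_prod_of_fintype fun m => ?_
  refine ((Complex.hasSum_taylorSeries_of_entire (hh m) 0 (x 2)).smul_const
    (genMatrix m 0 x)).congr_fun fun k => ?_
  rw [genMatrix_eq_smul, smul_smul, sub_zero, smul_eq_mul, smul_eq_mul, mul_assoc,
    mul_comm (iteratedDeriv _ _ _)]

lemma hasSum_smul_ofMatrixU (p : W2) {ι : Type*} {c : ι → ℂ} {M : ι → Matrix (Fin 3) (Fin 3) ℂ}
    {N : Matrix (Fin 3) (Fin 3) ℂ} (hM : HasSum (fun i => c i • M i) N) :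
    HasSum (fun i => c i • ofMatrixU p (M i)) (ofMatrixU p N) := by
  let L : Matrix (Fin 3) (Fin 3) ℂ →ₗ[ℂ] (C3 →L[ℂ] C3) := ofMatrixULinear p
  refine (hM.map L L.continuous_of_finiteDimensional).congr_fun fun i => ?_
  exact (map_smul (ofMatrixULinear p) (c i) (M i)).symm

theorem exists_hasSum_gen (ξ : H1) : ∃ (c : Fin 6 × ℕ → ℂ) (s : sections (U ⊓ V)),
    (∀ p, HasSum (fun i => c i • gen i p) (s.1 p)) ∧ cls s = ξ := by
  obtain ⟨σ, rfl⟩ := Submodule.mkQ_surjective _ ξ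
  have hσ := (isHolSection_iff_matrixU inf_le_left σ.1).1 σ.2
  rw [preimage_ptU_inf] at hσ
  obtain ⟨h, hh, hcob⟩ := hasNormalForm_of_differentiableOn hσ
  let M (x : C3) := ∑ m, h m (x 2) • genMatrix m 0 x
  have hM : IsHolSection (U ⊓ V) fun p => ofMatrixU p (M (coordU p)) := by
    refine isHolSection_ofMatrixU inf_le_left fun i j => ?_
    simp only [preimage_ptU_inf, M, Matrix.sum_apply, Matrix.smul_apply]
    exact .fun_sum fun m _ => .fun_smul
      ((hh m).comp (differentiable_apply 2)).differentiableOn (differentiableOn_genMatrix m 0 i j)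
  refine ⟨fun i => (i.2.factorial : ℂ)⁻¹ * iteratedDeriv i.2 (h i.1) 0, ⟨_, hM⟩, fun p => ?_,
    Eq.symm ((Submodule.Quotient.eq _).2 ?_)⟩
  · exact hasSum_smul_ofMatrixU p (hasSum_genMatrix hh (coordU p))
  · obtain ⟨A, B, hA, hB, hAB⟩ := hcob
    refine mem_range_cechD_iff_isCoboundary.2 ⟨A, B, hA, hB, fun x hx => ?_⟩
    have hM_matrix := matrixU_ofMatrixU M inf_le_left (ptU_mem_inf.2 hx)
    exact (((matrixU x).map_sub σ.1 _).trans (congrArg _ hM_matrix)).trans (hAB x hx)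

end Series

end LocalCY

end

open LocalCY in
/-- `W₂` has infinite-dimensional moduli of holomorphic bundles. -/
theorem mainTheorem5 :
    -- the Zariski tangent space of the moduli at `TW₂` is `H¹(W₂, End(TW₂))`,
    (∃ Φ : ModuliTangentSpace ≃ H1,
      ∀ g : FirstOrderDeformation, Φ (Quot.mk _ g) = cls g.cocycle) ∧
    -- which is infinite-dimensional;
    (¬ FiniteDimensional ℂ H1) ∧
    -- `TW₂` lies in effectively parametrised families of bundles of every dimension;
    (∀ n : ℕ, ∃ (𝓔 : Family n) (κ : (Fin n → ℂ) →ₗ[ℂ] sections (U ⊓ V)),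
      𝓔.IsKodairaSpencer κ ∧ Function.Injective fun v => cls (κ v)) ∧
    -- the listed cocycles are holomorphic, and every class is represented by a convergent series
    -- of multiples of them.
    (∀ i, gen i ∈ sections (U ⊓ V)) ∧
    (∀ x : H1, ∃ (c : Fin 6 × ℕ → ℂ) (s : sections (U ⊓ V)),
      (∀ p, HasSum (fun i => c i • gen i p) (s.1 p)) ∧ cls s = x) :=
  ⟨⟨moduliTangentSpaceEquiv, fun _ => rfl⟩,
    not_finiteDimensional_H1,
    fun n => ⟨.ofNilpotent (coefficientCocycle n) fun _ _ => isNilpotent_polynomialCocycle _ _,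
      coefficientCocycle n, Family.isKodairaSpencer_ofNilpotent _ _,
      injective_cls_coefficientCocycle n⟩,
    gen_mem,
    exists_hasSum_gen⟩
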